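/- Let $\|\cdot\|_2$ be the spectral norm and $\sigma_1(A)\ge\sigma_2(A)\ge\dots\ge\sigma_n(A)\ge 0$ the singular values of a matrix $A\in\mathbb R^{n\times n}$ (with $\sigma_{n+1}(A)=0$). A randomized algorithm $M$ assigns to every $A\in\mathbb R^{n\times n}$ a random matrix $M(A)\in\mathbb R^{n\times n}$; it is $(\varepsilon,\delta)$-differentially private under unit spectral perturbations if $\Pr\{M(A)\in S\}\le e^{\varepsilon}\Pr\{M(A')\in S\}+\delta$ for all $A,A'\in\mathbb R^{n\times n}$ with $\|A-A'\|_2\le 1$ and all measurable $S\subseteq\mathbb R^{n\times n}$. For $\gamma\in(0,1)$ and $\Gamma\in\mathbb R$, say that $A$ has $(\gamma,\Gamma)$-decay at $k$ if there is an index $c$ with $k<c\le \min(n,\Gamma k)$ and $\sigma_c(A)\le(1-\gamma)\,\sigma_k(A)$. For all $\gamma\in(0,1)$, $\Gamma\in\mathbb R$ and $a>0$ there is a constant $K>0$, depending only on $\gamma,\Gamma,a$, such that for all integers $n\ge 2$ and $1\le k\le n$ the following hold. (i) For all $0<\varepsilon\le 1$ and $0<\delta<1/2$ there is a randomized algorithm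 that is $(\varepsilon,\delta)$-differentially private under unit spectral perturbations, that on every input $A$ returns (almost surely) a matrix $A_k$ of rank at most $k$, and that satisfies, for every $A\in\mathbb R^{n\times n}$ with $(\gamma,\Gamma)$-decay at $k$, with probability at least $1-n^{-a}$, $$\|A-A_k\|_2\le\sigma_{k+1}(A)+K\,\varepsilon^{-1}k^2\sqrt{n\log(1/\delta)}\,\log n .$$ (ii) For all $\varepsilon>0$ there is a randomized algorithm that is $(\varepsilon,0)$-differentially private under unit spectral perturbations, that on every input $A$ returns (almost surely) a matrix $A_k$ of rank at most $k$, and that satisfies, for every $A\in\mathbb R^{n\times n}$ with $(\gamma,\Gamma)$-decay at $k$, with probability at least $1-n^{-a}$, $$\|A-A_k\|_2\le\sigma_{k+1}(A)+K\,\varepsilon^{-1}k^2\,n\,\log n .$$ -/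

import Mathlib

open MeasureTheory
open scoped ENNReal

/-- Entrywise (that is, Borel) measurable structure on real matrices. -/
noncomputable instance instMeasurableSpaceRealMatrix (n : ℕ) :
    MeasurableSpace (Matrix (Fin n) (Fin n) ℝ) :=
  inferInstanceAs (MeasurableSpace (Fin n → Fin n → ℝ))

/-- The spectral norm `‖A‖₂ = max_{‖x‖ = 1} ‖A x‖`, for the Euclidean norm. -/
noncomputable def spectralNorm₂ {n : ℕ} (A : Matrix (Fin n) (Fin n) ℝ) : ℝ :=
  ‖Matrix.toEuclideanCLM (n := Fin n) (𝕜 := ℝ) A‖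

/-- The `i`-th largest singular value `σ_i(A)`, counted from `i = 1` and with multiplicity;
it is `0` for `i > n`. Mathlib counts singular values from `0`. Only used for `1 ≤ i`. -/
noncomputable def sigma {n : ℕ} (i : ℕ) (A : Matrix (Fin n) (Fin n) ℝ) : ℝ :=
  (Matrix.toEuclideanLin A).singularValues (i - 1)

/-- Two matrices that differ by a unit spectral perturbation. -/
def SpectralNeighbors {n : ℕ} (A A' : Matrix (Fin n) (Fin n) ℝ) : Prop :=
  spectralNorm₂ (A - A') ≤ 1

/-- A randomized algorithm with inputs in `X` and outputs in `R`: for each input, the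
distribution of its output. -/
abbrev RandomizedAlgorithm (X R : Type*) [MeasurableSpace R] := X → ProbabilityMeasure R

/-- `(ε, δ)`-differential privacy with respect to the neighboring relation `nbr`. -/
def IsDifferentiallyPrivate {X R : Type*} [MeasurableSpace R] (nbr : X → X → Prop)
    (ε δ : ℝ) (M : RandomizedAlgorithm X R) : Prop :=
  ∀ x x' : X, nbr x x' → ∀ S : Set R, MeasurableSet S →
    (M x : Measure R) S
      ≤ ENNReal.ofReal (Real.exp ε) * (M x' : Measure R) S + ENNReal.ofReal δ

/-- The singular values of `A` decay by a factor `1 - γ` from position `k` to some later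
position `c ≤ Γ k`. -/
def HasSpectralDecay {n : ℕ} (γ Γ : ℝ) (k : ℕ) (A : Matrix (Fin n) (Fin n) ℝ) : Prop :=
  ∃ c : ℕ, k < c ∧ c ≤ n ∧ (c : ℝ) ≤ Γ * k ∧ sigma c A ≤ (1 - γ) * sigma k A

/-- On every input the output has rank at most `k` (almost surely), and on every input with the
decay property it is, with probability at least `1 - p`, within `σ_{k+1}(A) + err` of the input `A`
in spectral norm. -/
def ApproximatesRank {n : ℕ} (γ Γ : ℝ) (k : ℕ) (err p : ℝ)
    (M : RandomizedAlgorithm (Matrix (Fin n) (Fin n) ℝ) (Matrix (Fin n) (Fin n) ℝ)) : Prop :=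
  (∀ A, ∀ᵐ B ∂(M A : Measure (Matrix (Fin n) (Fin n) ℝ)), B.rank ≤ k) ∧
  ∀ A, HasSpectralDecay γ Γ k A →
    ENNReal.ofReal (1 - p) ≤
      (M A : Measure (Matrix (Fin n) (Fin n) ℝ))
        {B | spectralNorm₂ (A - B) ≤ sigma (k + 1) A + err}

/-! The algorithm shrinks the singular values of `A` by a soft threshold, adds noise, and truncates
the result to rank `k`. The threshold is placed at the last index `c ≤ min(n, Γk)`, which does not
depend on `A`. Singular values up to `σ_c` become `0`. Above it they grow with slope `C = 2/γ` until
they meet the identity. Under the decay hypothesis this has happened before `(1 - γ/2) σ_k`, so the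
part of `A` that matters for rank `k` is kept exactly.

Privacy rests on a sensitivity bound. In the left singular basis of `A` and the right singular basis
of a neighbor `A'`, the difference of the two cuts vanishes off the first `r = c - 1` rows and
columns. On these it is dominated entrywise by `A - A'`, its adjoint and the overlaps of the
singular bases (`sq_entry_le`). Each row and column of these has bounded square sum because `‖A -
A'‖ ≤ 1`. Hence the cut moves by `O(√r)` in Frobenius norm, which suits Gaussian noise and gives
(i), and by `O(r)` in nuclear norm, which suits noise of density `exp(-‖x‖₁/s)` and gives (ii).
Truncation is post-processing and costs no privacy.

Accuracy needs two facts. The noise has spectral norm `O(√n s)` or `O(n s)` with high probability,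
by averaging exponential moments of its bilinear forms over unit balls (`measure_le_norm_opOf_le`).
And truncating a perturbation of the cut matrix approximates `A` itself (`norm_sub_truncation_le`):
the gap between `σ_k` and `(1 - γ/2) σ_k` makes the truncation nearly block diagonal with respect to
the kept and the shrunk directions, as in Wedin's theorem, so the spectral error is a maximum over
the two blocks and not their sum. -/

open scoped InnerProductSpace

/-! ### Operators diagonal in two orthonormal bases, singular value decomposition, Weyl's inequality
-/

/-- The operator `∑ i, d i • ⟪v i, ·⟫ u i` that is diagonal for the orthonormal bases `v`, `u`. -/
noncomputable def diagOp {n : ℕ} (u : OrthonormalBasis (Fin n) ℝ (EuclideanSpace ℝ (Fin n)))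
    (d : Fin n → ℝ) (v : OrthonormalBasis (Fin n) ℝ (EuclideanSpace ℝ (Fin n))) :
    EuclideanSpace ℝ (Fin n) →L[ℝ] EuclideanSpace ℝ (Fin n) :=
  ∑ i, d i • InnerProductSpace.rankOne ℝ (u i) (v i)

section DiagOp

variable {n : ℕ} {u v w u' v' : OrthonormalBasis (Fin n) ℝ (EuclideanSpace ℝ (Fin n))}
  {d e d' : Fin n → ℝ}

lemma diagOp_apply (x : EuclideanSpace ℝ (Fin n)) :
    diagOp u d v x = ∑ i, (d i * ⟪v i, x⟫_ℝ) • u i := by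
  simp [diagOp, smul_smul]

lemma diagOp_apply_basis (i : Fin n) : diagOp u d v (v i) = d i • u i := by
  rw [diagOp_apply, Finset.sum_eq_single i]
  · simp
  · intro j _ hj
    simp [v.inner_eq_ite, hj]
  · simp

lemma inner_diagOp (i : Fin n) (x : EuclideanSpace ℝ (Fin n)) :
    ⟪u i, diagOp u d v x⟫_ℝ = d i * ⟪v i, x⟫_ℝ := by
  rw [diagOp_apply, inner_sum, Finset.sum_eq_single i]
  · simp [inner_smul_right]
  · intro j _ hj
    simp [inner_smul_right, u.inner_eq_ite, hj.symm]
  · simp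

lemma norm_sq_diagOp_apply (x : EuclideanSpace ℝ (Fin n)) :
    ‖diagOp u d v x‖ ^ 2 = ∑ i, d i ^ 2 * ⟪v i, x⟫_ℝ ^ 2 := by
  rw [← u.sum_sq_norm_inner_right]
  simp [inner_diagOp, mul_pow]

lemma ext_basis {S T : EuclideanSpace ℝ (Fin n) →L[ℝ] EuclideanSpace ℝ (Fin n)}
    (v : OrthonormalBasis (Fin n) ℝ (EuclideanSpace ℝ (Fin n))) (h : ∀ i, S (v i) = T (v i)) :
    S = T := by
  apply ContinuousLinearMap.coe_injective
  refine v.toBasis.ext fun i ↦ ?_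
  simpa using h i

lemma diagOp_comp : diagOp u d v * diagOp v e w = diagOp u (d * e) w := by
  refine ext_basis w fun i ↦ ?_
  simp [diagOp_apply_basis, smul_smul, mul_comm]

lemma diagOp_one : diagOp u 1 u = 1 := by
  refine ext_basis u fun i ↦ ?_
  simp [diagOp_apply_basis]

lemma diagOp_add : diagOp u (d + e) v = diagOp u d v + diagOp u e v := by
  simp [diagOp, add_smul, Finset.sum_add_distrib]

lemma diagOp_sub : diagOp u (d - e) v = diagOp u d v - diagOp u e v := by
  simp [diagOp, sub_smul, Finset.sum_sub_distrib]

lemma star_diagOp : star (diagOp u d v) = diagOp v d u := by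
  simp [diagOp, ContinuousLinearMap.star_eq_adjoint]

lemma norm_diagOp_le {r : ℝ} (hr : 0 ≤ r) (h : ∀ i, |d i| ≤ r) : ‖diagOp u d v‖ ≤ r := by
  refine ContinuousLinearMap.opNorm_le_bound _ hr fun x ↦ ?_
  refine le_of_sq_le_sq ?_ (by positivity)
  rw [norm_sq_diagOp_apply, mul_pow, ← v.sum_sq_norm_inner_right x, Finset.mul_sum]
  refine Finset.sum_le_sum fun i _ ↦ ?_
  rw [Real.norm_eq_abs, sq_abs]
  exact mul_le_mul_of_nonneg_right (sq_le_sq.2 ((h i).trans (le_abs_self r))) (sq_nonneg _)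

/-- Every operator on a Euclidean space has a singular value decomposition. -/
lemma exists_eq_diagOp (T : EuclideanSpace ℝ (Fin n) →L[ℝ] EuclideanSpace ℝ (Fin n)) :
    ∃ u v, T = diagOp u (fun i ↦ T.toLinearMap.singularValues i) v := by
  set T' := T.toLinearMap
  have hn : Module.finrank ℝ (EuclideanSpace ℝ (Fin n)) = n := by simp
  set v := T'.isSymmetric_adjoint_comp_self.eigenvectorBasis hn
  set s : Fin n → ℝ := fun i ↦ T'.singularValues i
  -- The images of the eigenvectors of `T* T` are orthogonal with norms `s i`. The nonzero ones can
  -- be normalized to give part of `u`; the rest of `u` is arbitrary.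
  have hin (i j : Fin n) : ⟪T' (v i), T' (v j)⟫_ℝ = if i = j then s j ^ 2 else 0 := by
    rw [← LinearMap.adjoint_inner_right, ← LinearMap.comp_apply,
      T'.isSymmetric_adjoint_comp_self.apply_eigenvectorBasis, inner_smul_right,
      v.inner_eq_ite, T'.sq_singularValues_fin hn]
    split_ifs <;> simp
  have ho : Orthonormal ℝ ({i | s i ≠ 0}.domRestrict fun i ↦ (s i)⁻¹ • T' (v i)) := by
    rw [orthonormal_iff_ite]
    rintro ⟨i, hi⟩ ⟨j, hj⟩
    simp only [Set.domRestrict_apply, inner_smul_left, inner_smul_right, hin, Subtype.mk.injEq]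
    split_ifs with h
    · subst h
      simp only [Set.mem_ofPred_eq] at hi
      simp; field_simp
    · simp
  obtain ⟨u, hu⟩ := ho.exists_orthonormalBasis_extension_of_card_eq (by simp)
  refine ⟨u, v, ext_basis v fun i ↦ ?_⟩
  rw [diagOp_apply_basis]
  change T' (v i) = s i • u i
  by_cases hi : s i = 0
  · have := hin i i
    simp only [hi, if_true] at this
    rw [hi, zero_smul, ← norm_eq_zero, ← sq_eq_zero_iff, ← real_inner_self_eq_norm_sq, this]
    simp
  · rw [hu i hi, smul_smul, mul_inv_cancel₀ hi, one_smul]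

/-- Weyl's inequality for singular values. -/
lemma diag_le_diag_add_norm_sub (hd : Antitone d) (hd0 : ∀ i, 0 ≤ d i) (he : Antitone d')
    (he0 : ∀ i, 0 ≤ d' i) (i : Fin n) :
    d i ≤ d' i + ‖diagOp u d v - diagOp u' d' v'‖ := by
  classical
  -- Dimension count: only `n - 1` linear conditions, so some `x ≠ 0` is orthogonal to `v' j` for `j
  -- < i` and to `v j` for `j > i`. On it the first operator stretches by at least `d i`, the second
  -- by at most `d' i`.
  let f : EuclideanSpace ℝ (Fin n) →ₗ[ℝ] ({j // j ≠ i} → ℝ) :=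
    LinearMap.pi fun j ↦ if j.1 < i then (innerSL ℝ (v' j)).toLinearMap
      else (innerSL ℝ (v j)).toLinearMap
  have hf : LinearMap.ker f ≠ ⊥ := by
    apply LinearMap.ker_ne_bot_of_finrank_lt
    have := i.pos
    simp [Fintype.card_subtype_compl]
    omega
  obtain ⟨x, hx, hx0⟩ := Submodule.exists_mem_ne_zero_of_ne_bot hf
  have hfx (j) : f x j = 0 := by rw [LinearMap.mem_ker.1 hx]; rfl
  have h1 (j) (hj : j < i) : ⟪v' j, x⟫_ℝ = 0 := by
    simpa [f, hj] using hfx ⟨j, hj.ne⟩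
  have h2 (j) (hj : i < j) : ⟪v j, x⟫_ℝ = 0 := by
    simpa [f, hj.le.not_gt] using hfx ⟨j, hj.ne'⟩
  have h3 : d i * ‖x‖ ≤ ‖diagOp u d v x‖ := by
    refine le_of_sq_le_sq ?_ (by positivity)
    rw [norm_sq_diagOp_apply, mul_pow, ← v.sum_sq_norm_inner_right x, Finset.mul_sum]
    refine Finset.sum_le_sum fun j _ ↦ ?_
    rcases lt_or_ge i j with h | h
    · simp [h2 j h]
    · rw [Real.norm_eq_abs, sq_abs]
      have := hd h
      have := hd0 i
      gcongr
  have h4 : ‖diagOp u' d' v' x‖ ≤ d' i * ‖x‖ := by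
    refine le_of_sq_le_sq ?_ (mul_nonneg (he0 i) (norm_nonneg _))
    rw [norm_sq_diagOp_apply, mul_pow, ← v'.sum_sq_norm_inner_right x, Finset.mul_sum]
    refine Finset.sum_le_sum fun j _ ↦ ?_
    rcases lt_or_ge j i with h | h
    · simp [h1 j h]
    · rw [Real.norm_eq_abs, sq_abs]
      have := he h
      have := he0 j
      gcongr
  have h5 := (diagOp u d v - diagOp u' d' v').le_opNorm x
  have h6 : ‖diagOp u d v x‖ ≤ ‖diagOp u' d' v' x‖ + ‖(diagOp u d v - diagOp u' d' v') x‖ := by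
    have := norm_add_le (diagOp u' d' v' x) ((diagOp u d v - diagOp u' d' v') x)
    simpa using this
  have hx' : 0 < ‖x‖ := norm_pos_iff.2 hx0
  nlinarith

end DiagOp

/-! ### Rank-`k` truncation of a perturbed soft cut -/

section Truncation

variable {n : ℕ} {u v p q : OrthonormalBasis (Fin n) ℝ (EuclideanSpace ℝ (Fin n))}
  {σ φ s a : Fin n → ℝ}

lemma norm_sq_add_norm_sq_diagOp (ha : ∀ i, a i = 0 ∨ a i = 1) (x : EuclideanSpace ℝ (Fin n)) :
    ‖diagOp u a u x‖ ^ 2 + ‖diagOp u (1 - a) u x‖ ^ 2 = ‖x‖ ^ 2 := by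
  rw [norm_sq_diagOp_apply, norm_sq_diagOp_apply, ← u.sum_sq_norm_inner_right x,
    ← Finset.sum_add_distrib]
  refine Finset.sum_congr rfl fun i _ ↦ ?_
  rcases ha i with h | h <;> simp [h]

/-- The norm of a block diagonal operator is the maximum of the norms of its blocks. -/
lemma norm_block_diag_le (ha : ∀ i, a i = 0 ∨ a i = 1)
    {S T : EuclideanSpace ℝ (Fin n) →L[ℝ] EuclideanSpace ℝ (Fin n)} {r : ℝ}
    (hS : ‖S‖ ≤ r) (hT : ‖T‖ ≤ r) :
    ‖diagOp u a u * S * diagOp v a v + diagOp u (1 - a) u * T * diagOp v (1 - a) v‖ ≤ r := by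
  have hr : 0 ≤ r := (norm_nonneg _).trans hS
  have haa : a * a = a := by ext i; rcases ha i with h | h <;> simp [h]
  have e1 : diagOp u a u * diagOp u a u = diagOp u a u := by rw [diagOp_comp, haa]
  have e2 : diagOp u a u * diagOp u (1 - a) u = 0 := by
    rw [diagOp_comp, mul_sub, mul_one, haa, sub_self]; simp [diagOp]
  have e3 : diagOp u (1 - a) u * diagOp u a u = 0 := by
    rw [diagOp_comp, sub_mul, one_mul, haa, sub_self]; simp [diagOp]
  have e4 : diagOp u (1 - a) u * diagOp u (1 - a) u = diagOp u (1 - a) u := by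
    rw [diagOp_comp, mul_sub, mul_one, sub_mul, one_mul, haa, sub_self, sub_zero]
  refine ContinuousLinearMap.opNorm_le_bound _ hr fun x ↦ ?_
  refine le_of_sq_le_sq ?_ (by positivity)
  -- Pythagoras on both sides: the two blocks have orthogonal ranges and see orthogonal components
  -- of `x`.
  rw [← norm_sq_add_norm_sq_diagOp (u := u) ha, mul_pow, ← norm_sq_add_norm_sq_diagOp (u := v) ha x]
  simp only [← mul_apply_eq_comp, mul_add, ← mul_assoc, e1, e2, e3, e4, zero_mul,
    zero_add, add_zero]
  have h1 : ‖diagOp u a u‖ ≤ 1 := norm_diagOp_le zero_le_one fun i ↦ by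
    rcases ha i with h | h <;> simp [h]
  have h2 : ‖diagOp u (1 - a) u‖ ≤ 1 := norm_diagOp_le zero_le_one fun i ↦ by
    rcases ha i with h | h <;> simp [h]
  have key {P S : EuclideanSpace ℝ (Fin n) →L[ℝ] EuclideanSpace ℝ (Fin n)} (hP : ‖P‖ ≤ 1)
      (hS : ‖S‖ ≤ r) (z : EuclideanSpace ℝ (Fin n)) : ‖P (S z)‖ ^ 2 ≤ r ^ 2 * ‖z‖ ^ 2 := by
    rw [← mul_pow]
    gcongr
    calc ‖P (S z)‖ ≤ 1 * ‖S z‖ := P.le_of_opNorm_le hP _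
      _ ≤ r * ‖z‖ := by rw [one_mul]; exact S.le_of_opNorm_le hS _
  simp only [mul_apply_eq_comp]
  have := key h1 hS (diagOp v a v x)
  have := key h2 hT (diagOp v (1 - a) v x)
  linarith

/-- If `φ` agrees with the singular values `σ` of `A` above `(1 - γ / 2) σ_k`, then the rank-`k`
truncation of any perturbation of `∑ φ_i u_i v_iᵀ` is almost as good as the one of `A`. -/
lemma norm_sub_truncation_le {γ e : ℝ} (hγ : 0 < γ) (hγ1 : γ < 1) {j k : Fin n}
    (hjk : (j : ℕ) + 1 = k)
    (hσ : Antitone σ) (hσ0 : ∀ i, 0 ≤ σ i) (hφ : Antitone φ) (hφ0 : ∀ i, 0 ≤ φ i)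
    (hφσ : ∀ i, φ i ≤ σ i) (hs : Antitone s) (hs0 : ∀ i, 0 ≤ s i)
    (heq : ∀ i, (1 - γ / 2) * σ j < σ i → φ i = σ i)
    (he : ‖diagOp p s q - diagOp u φ v‖ ≤ e) :
    ‖diagOp u σ v - diagOp p (fun i ↦ if i < k then s i else 0) q‖ ≤ σ k + 26 / γ * e := by
  have he0 : 0 ≤ e := (norm_nonneg _).trans he
  set W := diagOp p (fun i ↦ if i < k then s i else 0) q with hW
  have hsk : s k ≤ σ k + e := by
    have := diag_le_diag_add_norm_sub (u := p) (v := q) (u' := u) (v' := v) hs hs0 hφ hφ0 k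
    linarith [hφσ k]
  have hBW : ‖diagOp p s q - W‖ ≤ σ k + e := by
    rw [hW, ← diagOp_sub]
    refine (norm_diagOp_le (hs0 k) fun i ↦ ?_).trans hsk
    simp only [Pi.sub_apply]
    split_ifs with h
    · simpa using hs0 k
    · rw [sub_zero, abs_of_nonneg (hs0 i)]
      exact hs (not_lt.1 h)
  have hFW : ‖diagOp u φ v - W‖ ≤ σ k + 2 * e := by
    calc ‖diagOp u φ v - W‖ = ‖(diagOp p s q - W) - (diagOp p s q - diagOp u φ v)‖ := by
          congr 1; abel
      _ ≤ σ k + 2 * e := by linarith [norm_sub_le (diagOp p s q - W) (diagOp p s q - diagOp u φ v)]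
  have hjk' : j < k := by rw [Fin.lt_def]; omega
  have hge : 26 * e ≤ 26 / γ * e := by
    have : 26 ≤ 26 / γ := by rw [le_div_iff₀ hγ]; linarith
    exact mul_le_mul_of_nonneg_right this he0
  -- Without a gap that is large compared with `e`, `σ j` is itself `O(e / γ)` and the triangle
  -- inequality through `F` suffices.
  rcases le_or_gt (γ * σ j) (4 * e) with hsmall | hlarge
  · have hAF : ‖diagOp u σ v - diagOp u φ v‖ ≤ σ j := by
      rw [← diagOp_sub]
      refine norm_diagOp_le (hσ0 j) fun i ↦ ?_
      rw [Pi.sub_apply, abs_of_nonneg (sub_nonneg.2 (hφσ i))]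
      by_cases h : (1 - γ / 2) * σ j < σ i
      · rw [heq i h, sub_self]; exact hσ0 j
      · nlinarith [hσ0 j, hφ0 i]
    have h1 : σ j ≤ 4 / γ * e := by
      rw [div_mul_eq_mul_div, le_div_iff₀ hγ]; linarith
    have h2 : 26 / γ * e = 4 / γ * e + 22 / γ * e := by ring
    have h3 : 22 * e ≤ 22 / γ * e := by
      have : 22 ≤ 22 / γ := by rw [le_div_iff₀ hγ]; linarith
      exact mul_le_mul_of_nonneg_right this he0
    calc ‖diagOp u σ v - W‖ = ‖(diagOp u σ v - diagOp u φ v) + (diagOp u φ v - W)‖ := by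
          congr 1; abel
      _ ≤ _ := by linarith [norm_add_le (diagOp u σ v - diagOp u φ v) (diagOp u φ v - W)]
  have hσj : 0 < σ j := by
    by_contra h
    nlinarith
  set θ := (1 - γ / 2) * σ j with hθ
  have hθ0 : 0 ≤ θ := mul_nonneg (by linarith) hσj.le
  have hsj : σ j - e ≤ s j := by
    have := diag_le_diag_add_norm_sub (u := u) (v := v) (u' := p) (v' := q) hφ hφ0 hs hs0 j
    rw [norm_sub_rev] at this
    have h2 := heq j (by nlinarith)
    linarith
  have hsj0 : 0 < s j := by nlinarith
  -- `PU`, `PV` project to the singular directions above `θ`, where `F` and `A` agree; `QU`, `QV`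
  -- project to the others.
  set a : Fin n → ℝ := fun i ↦ if θ < σ i then 1 else 0 with ha'
  have ha (i) : a i = 0 ∨ a i = 1 := by
    by_cases h : θ < σ i <;> simp [ha', h]
  have ha2 (i) : (1 - a) i = 0 ∨ (1 - a) i = 1 := by
    rcases ha i with h | h <;> simp [h]
  have norm_proj {w : OrthonormalBasis (Fin n) ℝ (EuclideanSpace ℝ (Fin n))} {b : Fin n → ℝ}
      (hb : ∀ i, b i = 0 ∨ b i = 1) : ‖diagOp w b w‖ ≤ 1 :=
    norm_diagOp_le zero_le_one fun i ↦ by rcases hb i with h | h <;> simp [h]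
  set PU := diagOp u a u with hPU
  set PV := diagOp v a v with hPV
  set QU := diagOp u (1 - a) u with hQU
  set QV := diagOp v (1 - a) v with hQV
  have hPQU : PU + QU = 1 := by rw [hPU, hQU, ← diagOp_add, add_sub_cancel, diagOp_one]
  have hPQV : PV + QV = 1 := by rw [hPV, hQV, ← diagOp_add, add_sub_cancel, diagOp_one]
  set F := diagOp u φ v with hF
  set A := diagOp u σ v with hA
  set B := diagOp p s q with hB
  set t : Fin n → ℝ := fun i ↦ if i < k then 1 else 0 with ht'
  have ht (i) : t i = 0 ∨ t i = 1 := by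
    by_cases h : i < k <;> simp [ht', h]
  -- `R` is the adjoint of the pseudoinverse of `W`. It expresses the projections to the leading `p`
  -- and `q` through `star W`, at the price of a factor `(s j)⁻¹`.
  set R := diagOp p (fun i ↦ if i < k then (s i)⁻¹ else 0) q with hR
  have hst (i) (h : i < k) : s j ≤ s i := hs (by rw [Fin.lt_def] at h; rw [Fin.le_def]; omega)
  have hRn : ‖R‖ ≤ (s j)⁻¹ := by
    refine norm_diagOp_le (inv_nonneg.2 hsj0.le) fun i ↦ ?_
    split_ifs with h
    · rw [abs_of_nonneg (inv_nonneg.2 (hs0 i))]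
      exact inv_anti₀ hsj0 (hst i h)
    · simpa using hs0 j
  have hWq : W = B * diagOp q t q := by
    rw [hW, hB, diagOp_comp]; congr 1; ext i; simp [ht']
  have hWp : W = diagOp p t p * B := by
    rw [hW, hB, diagOp_comp]; congr 1; ext i; simp [ht']
  have hq : diagOp q t q = star W * R := by
    rw [hW, star_diagOp, hR, diagOp_comp]; congr 1; ext i
    by_cases h : i < k
    · have := (hsj0.trans_le (hst i h)).ne'
      simp [ht', h, this]
    · simp [ht', h]
  have hp : diagOp p t p = R * star W := by
    rw [hW, star_diagOp, hR, diagOp_comp]; congr 1; ext i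
    by_cases h : i < k
    · have := (hsj0.trans_le (hst i h)).ne'
      simp [ht', h, this]
    · simp [ht', h]
  have hQF : QU * F = QU * F * QV := by
    rw [hQU, hF, hQV, diagOp_comp, diagOp_comp]; congr 1; ext i
    rcases ha i with h | h <;> simp [h]
  have hFQ : F * QV = QU * F * QV := by
    rw [hQU, hF, hQV, diagOp_comp, diagOp_comp, diagOp_comp]; congr 1; ext i
    rcases ha i with h | h <;> simp [h]
  have hQFn : ‖QU * F * QV‖ ≤ θ := by
    rw [hQU, hF, hQV, diagOp_comp, diagOp_comp]
    refine norm_diagOp_le hθ0 fun i ↦ ?_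
    by_cases h : θ < σ i
    · simpa [ha', h] using hθ0
    · simp only [ha', Pi.mul_apply, Pi.sub_apply, Pi.one_apply, h, if_false]
      rw [sub_zero, one_mul, mul_one, abs_of_nonneg (hφ0 i)]
      exact (hφσ i).trans (not_lt.1 h)
  have norm_le_mul {S T : EuclideanSpace ℝ (Fin n) →L[ℝ] EuclideanSpace ℝ (Fin n)} {x y : ℝ}
      (hS : ‖S‖ ≤ x) (hT : ‖T‖ ≤ y) : ‖S * T‖ ≤ x * y :=
    (norm_mul_le S T).trans (mul_le_mul hS hT (norm_nonneg _) ((norm_nonneg _).trans hS))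
  have hQVs : star QV = QV := by rw [hQV, star_diagOp]
  have hQUs : star QU = QU := by rw [hQU, star_diagOp]
  -- Replace `B` by `F` at cost `e`. Since `F` commutes with the splitting and is at most `θ` on the
  -- `Q` side, `QU * W` is bounded by `θ / s j` times the other off-block `W * QV`, plus `e`; `hy`
  -- is the mirror image.
  have hx : ‖QU * W‖ ≤ θ * (‖W * QV‖ * (s j)⁻¹) + e := by
    have h1 : QU * W = QU * F * QV * (QV * star W * R) + QU * (B - F) * diagOp q t q := by
      have : QU * F * QV * QV = QU * F * QV := by
        rw [hQU, hF, hQV, diagOp_comp, diagOp_comp, diagOp_comp]; congr 1; ext i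
        rcases ha i with h | h <;> simp [h]
      rw [← mul_assoc, ← mul_assoc, this, ← hQF, mul_assoc (QU * F), ← hq]
      nth_rw 1 [hWq]
      simp only [mul_sub, sub_mul, mul_assoc]
      abel
    have h2 : ‖QV * star W‖ = ‖W * QV‖ := by
      rw [← norm_star (W * QV), star_mul, hQVs]
    rw [h1]
    refine (norm_add_le _ _).trans (add_le_add ?_ ?_)
    · exact norm_le_mul hQFn (norm_le_mul h2.le hRn)
    · simpa using norm_le_mul (norm_le_mul (norm_proj ha2) he) (norm_proj ht)
  have hy : ‖W * QV‖ ≤ θ * ((s j)⁻¹ * ‖QU * W‖) + e := by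
    have h1 : W * QV = R * (star W * QU) * (QU * F * QV) + diagOp p t p * (B - F) * QV := by
      have : QU * (QU * F * QV) = QU * F * QV := by
        rw [hQU, hF, hQV, diagOp_comp, diagOp_comp, diagOp_comp]; congr 1; ext i
        rcases ha i with h | h <;> simp [h]
      rw [mul_assoc R, mul_assoc (star W), this, ← hFQ, ← mul_assoc, ← hp]
      nth_rw 1 [hWp]
      simp only [mul_sub, sub_mul, mul_assoc]
      abel
    have h2 : ‖star W * QU‖ = ‖QU * W‖ := by
      rw [← norm_star (QU * W), star_mul, hQUs]
    rw [h1]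
    refine (norm_add_le _ _).trans (add_le_add ?_ ?_)
    · rw [mul_comm θ]
      exact norm_le_mul (norm_le_mul hRn h2.le) hQFn
    · simpa using norm_le_mul (norm_le_mul (norm_proj ht) he) (norm_proj ha2)
  have hblock : ‖PU * (F - W) * PV + QU * A * QV‖ ≤ σ k + 2 * e := by
    have : QU * A * QV = QU * (QU * A * QV) * QV := by
      rw [hQU, hA, hQV]
      simp only [diagOp_comp]; congr 1; ext i
      rcases ha i with h | h <;> simp [h]
    rw [this]
    refine norm_block_diag_le ha hFW ?_
    rw [hQU, hA, hQV, diagOp_comp, diagOp_comp]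
    refine (norm_diagOp_le (hσ0 k) fun i ↦ ?_).trans (by linarith)
    by_cases h : θ < σ i
    · simpa [ha', h] using hσ0 k
    · simp only [ha', Pi.mul_apply, Pi.sub_apply, Pi.one_apply, h, if_false]
      rw [sub_zero, one_mul, mul_one, abs_of_nonneg (hσ0 i)]
      -- Indices up to `j = k - 1` have `σ i ≥ σ j > θ`, so an index not above `θ` is at least `k`.
      refine hσ ?_
      by_contra hik
      have : σ j ≤ σ i := hσ (by rw [Fin.le_def]; rw [not_le, Fin.lt_def] at hik; omega)
      nlinarith
  have hsplit : A - W = (PU * (F - W) * PV + QU * A * QV) - PU * (W * QV) - QU * W := by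
    have h1 : A = PU * F * PV + QU * A * QV := by
      rw [hQU, hA, hQV, hPU, hF, hPV]
      simp only [diagOp_comp, ← diagOp_add]; congr 1; ext i
      by_cases h : θ < σ i
      · simp [ha', h, heq i h]
      · simp [ha', h]
    have h2 : W = PU * W * PV + PU * (W * QV) + QU * W := by
      rw [mul_assoc, ← mul_add, ← mul_add, hPQV, mul_one, ← add_mul, hPQU, one_mul]
    nth_rw 1 [h1]
    nth_rw 1 [h2]
    simp only [mul_sub, sub_mul, mul_assoc]
    abel
  have hPWQ : ‖PU * (W * QV)‖ ≤ ‖W * QV‖ := by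
    simpa using norm_le_mul (norm_proj (w := u) ha) le_rfl
  have htot : ‖A - W‖ ≤ σ k + 2 * e + ‖W * QV‖ + ‖QU * W‖ := by
    rw [hsplit]
    refine (norm_sub_le _ _).trans (add_le_add ?_ le_rfl)
    refine (norm_sub_le _ _).trans (add_le_add hblock hPWQ)
  -- The two coupled inequalities are added; the sum is controlled because `θ < s j`.
  have hsum : (‖W * QV‖ + ‖QU * W‖) * (s j - θ) ≤ 2 * e * s j := by
    have h1 : (‖W * QV‖ + ‖QU * W‖) ≤ θ * (s j)⁻¹ * (‖W * QV‖ + ‖QU * W‖) + 2 * e := by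
      linarith
    have h2 := mul_le_mul_of_nonneg_right h1 hsj0.le
    have h3 : (θ * (s j)⁻¹ * (‖W * QV‖ + ‖QU * W‖) + 2 * e) * s j
        = θ * (‖W * QV‖ + ‖QU * W‖) + 2 * e * s j := by
      field_simp
    rw [h3] at h2
    linarith
  -- From `s j ≥ (1 - γ/4) σ j` and `(1 - γ/4)² ≥ 1 - γ/2`.
  have hgap : γ / 4 * s j ≤ s j - θ := by
    nlinarith
  have hfin : (‖W * QV‖ + ‖QU * W‖) ≤ 8 / γ * e := by
    have h0 : 0 ≤ ‖W * QV‖ + ‖QU * W‖ := by positivity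
    have h1 : (‖W * QV‖ + ‖QU * W‖) * (γ / 4 * s j) ≤ 2 * e * s j :=
      (mul_le_mul_of_nonneg_left hgap h0).trans hsum
    have h2 : (‖W * QV‖ + ‖QU * W‖) * (γ / 4) ≤ 2 * e := by
      refine le_of_mul_le_mul_right ?_ hsj0
      linarith
    rw [div_mul_eq_mul_div, le_div_iff₀ hγ]
    linarith
  have h10 : 26 / γ * e = 8 / γ * e + 18 / γ * e := by ring
  have h11 : 18 * e ≤ 18 / γ * e := by
    have : 18 ≤ 18 / γ := by rw [le_div_iff₀ hγ]; linarith
    exact mul_le_mul_of_nonneg_right this he0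
  linarith

end Truncation

/-! ### Matrices as a Euclidean space with the Frobenius inner product -/

section MatrixSpace

variable {n : ℕ}

/-- The matrix with the entries `x (i, j)`, as an operator on Euclidean space. The Euclidean norm
of `x` is the Frobenius norm of the matrix. -/
noncomputable def opOf (x : EuclideanSpace ℝ (Fin n × Fin n)) :
    EuclideanSpace ℝ (Fin n) →L[ℝ] EuclideanSpace ℝ (Fin n) :=
  Matrix.toEuclideanCLM (n := Fin n) (𝕜 := ℝ) (Matrix.of fun i j ↦ x (i, j))

/-- The entries of an operator on Euclidean space. -/
noncomputable def ofOp (T : EuclideanSpace ℝ (Fin n) →L[ℝ] EuclideanSpace ℝ (Fin n)) :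
    EuclideanSpace ℝ (Fin n × Fin n) :=
  WithLp.toLp 2 fun ij ↦ (Matrix.toEuclideanCLM (n := Fin n) (𝕜 := ℝ)).symm T ij.1 ij.2

/-- The entries of the rank-one matrix `y zᵀ`. -/
noncomputable def tensor (y z : EuclideanSpace ℝ (Fin n)) : EuclideanSpace ℝ (Fin n × Fin n) :=
  WithLp.toLp 2 fun ij ↦ y ij.1 * z ij.2

lemma opOf_ofOp (T : EuclideanSpace ℝ (Fin n) →L[ℝ] EuclideanSpace ℝ (Fin n)) :
    opOf (ofOp T) = T := by
  have : Matrix.of (fun i j ↦ ofOp T (i, j)) = (Matrix.toEuclideanCLM (n := Fin n) (𝕜 := ℝ)).symm T := by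
    ext i j; rfl
  rw [opOf, this]
  simp

lemma opOf_add (x y : EuclideanSpace ℝ (Fin n × Fin n)) : opOf (x + y) = opOf x + opOf y := by
  rw [opOf, opOf, opOf, ← map_add]; rfl

lemma opOf_sub (x y : EuclideanSpace ℝ (Fin n × Fin n)) : opOf (x - y) = opOf x - opOf y := by
  rw [opOf, opOf, opOf, ← map_sub]; rfl

lemma inner_tensor (x : EuclideanSpace ℝ (Fin n × Fin n)) (y z : EuclideanSpace ℝ (Fin n)) :
    ⟪x, tensor y z⟫_ℝ = ⟪y, opOf x z⟫_ℝ := by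
  rw [opOf, Matrix.inner_toEuclideanCLM, PiLp.inner_apply, Fintype.sum_prod_type]
  simp only [tensor, dotProduct, Matrix.mulVec, Finset.mul_sum]
  refine Finset.sum_congr rfl fun i _ ↦ Finset.sum_congr rfl fun j _ ↦ ?_
  simp
  ring

lemma inner_tensor_tensor (a b y z : EuclideanSpace ℝ (Fin n)) :
    ⟪tensor a b, tensor y z⟫_ℝ = ⟪a, y⟫_ℝ * ⟪b, z⟫_ℝ := by
  rw [PiLp.inner_apply, PiLp.inner_apply, PiLp.inner_apply, Fintype.sum_prod_type,
    Finset.sum_mul_sum]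
  refine Finset.sum_congr rfl fun i _ ↦ Finset.sum_congr rfl fun j _ ↦ ?_
  simp [tensor]
  ring

lemma norm_tensor (y z : EuclideanSpace ℝ (Fin n)) : ‖tensor y z‖ = ‖y‖ * ‖z‖ := by
  rw [← sq_eq_sq₀ (by positivity) (by positivity), ← real_inner_self_eq_norm_sq,
    inner_tensor_tensor, real_inner_self_eq_norm_sq, real_inner_self_eq_norm_sq, mul_pow]

lemma norm_opOf_le (x : EuclideanSpace ℝ (Fin n × Fin n)) : ‖opOf x‖ ≤ ‖x‖ := by
  refine ContinuousLinearMap.opNorm_le_bound _ (norm_nonneg _) fun z ↦ ?_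
  have h := real_inner_le_norm x (tensor (opOf x z) z)
  rw [inner_tensor, real_inner_self_eq_norm_sq, norm_tensor] at h
  rcases (norm_nonneg (opOf x z)).eq_or_lt with h0 | h0
  · rw [← h0]; positivity
  · refine le_of_mul_le_mul_left ?_ h0
    linarith

/-- The Frobenius inner product in terms of arbitrary orthonormal bases. -/
lemma inner_eq_sum_inner_opOf (u v : OrthonormalBasis (Fin n) ℝ (EuclideanSpace ℝ (Fin n)))
    (x y : EuclideanSpace ℝ (Fin n × Fin n)) :
    ⟪x, y⟫_ℝ = ∑ i, ∑ j, ⟪u i, opOf x (v j)⟫_ℝ * ⟪u i, opOf y (v j)⟫_ℝ := by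
  have ho : Orthonormal ℝ (Set.univ.domRestrict fun ij : Fin n × Fin n ↦ tensor (u ij.1) (v ij.2)) := by
    rw [orthonormal_iff_ite]
    rintro ⟨⟨i, j⟩, _⟩ ⟨⟨k, l⟩, _⟩
    simp only [Set.domRestrict_apply, inner_tensor_tensor, u.inner_eq_ite, v.inner_eq_ite,
      Subtype.mk.injEq, Prod.mk.injEq]
    split_ifs <;> simp_all
  obtain ⟨b, hb⟩ := ho.exists_orthonormalBasis_extension_of_card_eq (by simp)
  rw [← b.sum_inner_mul_inner x y, Fintype.sum_prod_type]
  refine Finset.sum_congr rfl fun i _ ↦ Finset.sum_congr rfl fun j _ ↦ ?_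
  rw [hb _ (Set.mem_univ _), inner_tensor, real_inner_comm y, inner_tensor]

end MatrixSpace

/-! ### The soft threshold -/

/-- The function that is `0` up to `τ`, then grows with slope `C` until it meets the identity. -/
noncomputable def softCut (C τ x : ℝ) : ℝ := min x (C * max (x - τ) 0)

section SoftCut

variable {C τ τ' x y : ℝ}

lemma softCut_le : softCut C τ x ≤ x := min_le_left _ _

lemma softCut_nonneg (hC : 0 ≤ C) (hx : 0 ≤ x) : 0 ≤ softCut C τ x :=
  le_min hx (mul_nonneg hC (le_max_right _ _))

lemma softCut_of_le (hx : 0 ≤ x) (h : x ≤ τ) : softCut C τ x = 0 := by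
  rw [softCut, max_eq_right (by linarith), mul_zero, min_eq_right hx]

lemma softCut_of_mul_le (hC : 0 ≤ C) (h : C * τ ≤ (C - 1) * x) : softCut C τ x = x := by
  refine min_eq_left ?_
  have := mul_le_mul_of_nonneg_left (le_max_left (x - τ) 0) hC
  linarith

lemma softCut_mono (hC : 0 ≤ C) : Monotone (softCut C τ) := fun x y h ↦
  min_le_min h (mul_le_mul_of_nonneg_left (max_le_max (by linarith) le_rfl) hC)

/-- Joint Lipschitz continuity is needed because the threshold is a singular value and itself moves
between neighbors. -/
lemma abs_softCut_sub_le (hC : 1 ≤ C) :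
    |softCut C τ x - softCut C τ' y| ≤ C * (|x - y| + |τ - τ'|) := by
  have h0 : 0 ≤ |τ - τ'| := abs_nonneg _
  have h0' : 0 ≤ |x - y| := abs_nonneg _
  refine (abs_min_sub_min_le_max _ _ _ _).trans (max_le (by nlinarith) ?_)
  rw [← mul_sub, abs_mul, abs_of_nonneg (by linarith : 0 ≤ C)]
  gcongr
  refine (abs_max_sub_max_le_max _ _ _ _).trans (max_le ?_ (by simp; positivity))
  calc |x - τ - (y - τ')| = |(x - y) - (τ - τ')| := by ring_nf
    _ ≤ _ := abs_sub _ _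

end SoftCut

/-! ### Sensitivity of the soft cut in Frobenius and nuclear norm -/

section Sensitivity

variable {n : ℕ}

/-- There are `r` rows and `r` columns, each of sum at most `b`; counting the common square twice is
harmless. -/
lemma sum_sum_ite_le {g : Fin n → Fin n → ℝ} {b : ℝ} (r : Fin n) (hg : ∀ i j, 0 ≤ g i j)
    (h1 : ∀ i, ∑ j, g i j ≤ b) (h2 : ∀ j, ∑ i, g i j ≤ b) :
    ∑ i, ∑ j, (if i < r ∨ j < r then g i j else 0) ≤ 2 * r * b := by
  have hc : ∑ i : Fin n, (if i < r then b else 0) = r * b := by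
    rw [← Finset.sum_filter, Finset.sum_const, nsmul_eq_mul]
    congr 2
    rw [Finset.filter_gt_eq_Iio, Fin.card_Iio]
  calc ∑ i, ∑ j, (if i < r ∨ j < r then g i j else 0)
      ≤ ∑ i, ∑ j, ((if i < r then g i j else 0) + (if j < r then g i j else 0)) := by
        refine Finset.sum_le_sum fun i _ ↦ Finset.sum_le_sum fun j _ ↦ ?_
        have := hg i j
        split_ifs <;> simp_all
    _ = ∑ i, (if i < r then ∑ j, g i j else 0) + ∑ j, (if j < r then ∑ i, g i j else 0) := by
        simp_rw [Finset.sum_add_distrib]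
        congr 1
        · refine Finset.sum_congr rfl fun i _ ↦ ?_
          split_ifs <;> simp
        · rw [Finset.sum_comm]
          refine Finset.sum_congr rfl fun i _ ↦ ?_
          split_ifs <;> simp
    _ ≤ ∑ i : Fin n, (if i < r then b else 0) + ∑ i : Fin n, (if i < r then b else 0) := by
        gcongr with i _ j _
        · split_ifs
          · exact h1 i
          · rfl
        · split_ifs
          · exact h2 j
          · rfl
    _ = 2 * r * b := by rw [hc]; ring

lemma sum_sq_inner_apply_right_le (v : OrthonormalBasis (Fin n) ℝ (EuclideanSpace ℝ (Fin n)))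
    {T : EuclideanSpace ℝ (Fin n) →L[ℝ] EuclideanSpace ℝ (Fin n)} (hT : ‖T‖ ≤ 1)
    {x : EuclideanSpace ℝ (Fin n)} (hx : ‖x‖ = 1) : ∑ i, ⟪v i, T x⟫_ℝ ^ 2 ≤ 1 := by
  have h := v.sum_sq_norm_inner_right (T x)
  simp only [Real.norm_eq_abs, sq_abs] at h
  rw [h]
  refine pow_le_one₀ (norm_nonneg _) ?_
  simpa [hx] using T.le_of_opNorm_le hT x

lemma sum_sq_inner_apply_left_le (v : OrthonormalBasis (Fin n) ℝ (EuclideanSpace ℝ (Fin n)))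
    {T : EuclideanSpace ℝ (Fin n) →L[ℝ] EuclideanSpace ℝ (Fin n)} (hT : ‖T‖ ≤ 1)
    {x : EuclideanSpace ℝ (Fin n)} (hx : ‖x‖ = 1) : ∑ i, ⟪x, T (v i)⟫_ℝ ^ 2 ≤ 1 := by
  have hT' : ‖star T‖ ≤ 1 := (norm_star T).le.trans hT
  refine le_of_eq_of_le (Finset.sum_congr rfl fun i _ ↦ ?_) (sum_sq_inner_apply_right_le v hT' hx)
  rw [ContinuousLinearMap.star_eq_adjoint, ContinuousLinearMap.adjoint_inner_right, real_inner_comm]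

variable {u v u' v' : OrthonormalBasis (Fin n) ℝ (EuclideanSpace ℝ (Fin n))}
  {σ σ' : Fin n → ℝ} {C : ℝ}

/-- Symmetrizing decouples differences from sums: `(φa - ψb)² + (φb - ψa)²` equals half of `(φ -
ψ)²(a + b)² + (φ + ψ)²(a - b)²`, and likewise for `x, y`. The cut controls `φ - ψ` by its Lipschitz
bound and `φ + ψ` by `x + y`. This is why the adjoint entry `x b - y a` appears. -/
lemma sq_entry_le {a b x y φ ψ : ℝ} (hC : 1 ≤ C) (hφ : 0 ≤ φ)
    (hψ : 0 ≤ ψ) (hφx : φ ≤ x) (hψy : ψ ≤ y) (h : |φ - ψ| ≤ C * (|x - y| + 1)) :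
    (φ * a - ψ * b) ^ 2
      ≤ 2 * C ^ 2 * ((x * a - y * b) ^ 2 + (x * b - y * a) ^ 2 + (a ^ 2 + b ^ 2)) := by
  have h1 : (φ - ψ) ^ 2 ≤ 2 * C ^ 2 * ((x - y) ^ 2 + 1) := by
    rw [← sq_abs (φ - ψ), ← sq_abs (x - y)]
    have h2 : |φ - ψ| ^ 2 ≤ (C * (|x - y| + 1)) ^ 2 := by gcongr
    nlinarith [sq_nonneg (C * (|x - y| - 1))]
  have h2 : (φ + ψ) ^ 2 ≤ 2 * C ^ 2 * (x + y) ^ 2 := by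
    have h3 : (φ + ψ) ^ 2 ≤ (x + y) ^ 2 := by gcongr
    have h4 : 1 ≤ C ^ 2 := one_le_pow₀ hC
    nlinarith [mul_le_mul_of_nonneg_right h4 (sq_nonneg (x + y)), sq_nonneg (x + y)]
  have h3 := mul_le_mul_of_nonneg_right h1 (sq_nonneg (a + b))
  have h4 := mul_le_mul_of_nonneg_right h2 (sq_nonneg (a - b))
  have h5 : 0 ≤ C ^ 2 * (a - b) ^ 2 := by positivity
  nlinarith [sq_nonneg (φ * b - ψ * a)]

lemma inner_diagOp_sub (d d' : Fin n → ℝ) (i j : Fin n) :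
    ⟪u i, (diagOp u d v - diagOp u' d' v') (v' j)⟫_ℝ
      = d i * ⟪v i, v' j⟫_ℝ - d' j * ⟪u i, u' j⟫_ℝ := by
  rw [sub_apply, inner_sub_right, inner_diagOp, diagOp_apply_basis, inner_smul_right]

lemma star_diagOp_sub (d d' : Fin n → ℝ) :
    star (diagOp u d v - diagOp u' d' v') = diagOp v d u - diagOp v' d' u' := by
  rw [ContinuousLinearMap.star_eq_adjoint, map_sub, ← ContinuousLinearMap.star_eq_adjoint,
    ← ContinuousLinearMap.star_eq_adjoint, star_diagOp, star_diagOp]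

lemma norm_star_diagOp_sub (d d' : Fin n → ℝ) :
    ‖diagOp v d u - diagOp v' d' u'‖ = ‖diagOp u d v - diagOp u' d' v'‖ := by
  rw [← star_diagOp_sub]
  exact norm_star (diagOp u d v - diagOp u' d' v')

/-- The first `r` rows and columns of the overlaps of the singular bases of two neighbors. -/
lemma sum_overlap_le (r : Fin n) (h : ‖diagOp u σ v - diagOp u' σ' v'‖ ≤ 1) :
    ∑ i, ∑ j, (if i < r ∨ j < r then
      (σ i * ⟪v i, v' j⟫_ℝ - σ' j * ⟪u i, u' j⟫_ℝ) ^ 2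
      + (σ i * ⟪u i, u' j⟫_ℝ - σ' j * ⟪v i, v' j⟫_ℝ) ^ 2
      + (⟪v i, v' j⟫_ℝ ^ 2 + ⟪u i, u' j⟫_ℝ ^ 2) else 0) ≤ 2 * r * 4 := by
  have h' : ‖diagOp v σ u - diagOp v' σ' u'‖ ≤ 1 := (norm_star_diagOp_sub _ _).le.trans h
  have hid : ‖(1 : EuclideanSpace ℝ (Fin n) →L[ℝ] EuclideanSpace ℝ (Fin n))‖ ≤ 1 :=
    ContinuousLinearMap.norm_id_le
  refine sum_sum_ite_le r (fun i j ↦ by positivity) (fun i ↦ ?_) (fun j ↦ ?_)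
  -- The bound `4` per row is one each for the difference, its adjoint, and the coordinates of the
  -- unit vectors `v i` and `u i`.
  · have h1 := sum_sq_inner_apply_left_le v' h (u.norm_eq_one i)
    have h2 := sum_sq_inner_apply_left_le u' h' (v.norm_eq_one i)
    have h3 := sum_sq_inner_apply_left_le v' hid (v.norm_eq_one i)
    have h4 := sum_sq_inner_apply_left_le u' hid (u.norm_eq_one i)
    simp only [one_apply_eq_self] at h3 h4
    simp only [inner_diagOp_sub] at h1 h2
    simp only [Finset.sum_add_distrib]
    linarith
  · have h1 := sum_sq_inner_apply_right_le u h (v'.norm_eq_one j)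
    have h2 := sum_sq_inner_apply_right_le v h' (u'.norm_eq_one j)
    have h3 := sum_sq_inner_apply_right_le v hid (v'.norm_eq_one j)
    have h4 := sum_sq_inner_apply_right_le u hid (u'.norm_eq_one j)
    simp only [one_apply_eq_self] at h3 h4
    simp only [inner_diagOp_sub] at h1 h2
    simp only [Finset.sum_add_distrib]
    linarith

/-- The entries, in singular bases, of a difference of soft cuts of `A` and `A'` at the `r`-th
singular value. They vanish off the first `r` rows and columns. -/
lemma norm_sq_softCut_sub_le (hC : 1 ≤ C) (r : Fin n) (hσ : Antitone σ) (hσ0 : ∀ i, 0 ≤ σ i)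
    (hσ' : Antitone σ') (hσ0' : ∀ i, 0 ≤ σ' i)
    (h : ‖diagOp u σ v - diagOp u' σ' v'‖ ≤ 1) :
    (∀ i j, ¬ (i < r ∨ j < r) → ⟪u i, (diagOp u (softCut C (σ r) ∘ σ) v
        - diagOp u' (softCut C (σ' r) ∘ σ') v') (v' j)⟫_ℝ = 0) ∧
      ∑ i, ∑ j, ⟪u i, (diagOp u (softCut C (σ r) ∘ σ) v
        - diagOp u' (softCut C (σ' r) ∘ σ') v') (v' j)⟫_ℝ ^ 2 ≤ 16 * C ^ 2 * r := by
  have hC0 : 0 ≤ C := by linarith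
  have hτ : |σ r - σ' r| ≤ 1 := by
    rw [abs_le]
    have h1 := diag_le_diag_add_norm_sub (u := u) (v := v) (u' := u') (v' := v') hσ hσ0 hσ' hσ0' r
    have h2 := diag_le_diag_add_norm_sub (u := u') (v := v') (u' := u) (v' := v) hσ' hσ0' hσ hσ0 r
    rw [norm_sub_rev] at h2
    constructor <;> linarith
  have hzero (i j) (hij : ¬ (i < r ∨ j < r)) : ⟪u i, (diagOp u (softCut C (σ r) ∘ σ) v
        - diagOp u' (softCut C (σ' r) ∘ σ') v') (v' j)⟫_ℝ = 0 := by
    simp only [not_or, not_lt] at hij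
    rw [inner_diagOp_sub, Function.comp_apply, Function.comp_apply, softCut_of_le (hσ0 i) (hσ hij.1),
      softCut_of_le (hσ0' j) (hσ' hij.2)]
    simp
  refine ⟨hzero, ?_⟩
  rw [show 16 * C ^ 2 * r = 2 * C ^ 2 * (2 * r * 4) by ring]
  refine le_trans ?_ (mul_le_mul_of_nonneg_left (sum_overlap_le r h) (by positivity))
  rw [Finset.mul_sum]
  refine Finset.sum_le_sum fun i _ ↦ ?_
  rw [Finset.mul_sum]
  refine Finset.sum_le_sum fun j _ ↦ ?_
  split_ifs with hij
  · rw [inner_diagOp_sub]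
    refine sq_entry_le hC (softCut_nonneg hC0 (hσ0 i))
      (softCut_nonneg hC0 (hσ0' j)) softCut_le softCut_le ?_
    refine (abs_softCut_sub_le hC).trans ?_
    gcongr
  · rw [hzero i j hij]; simp

/-- The soft cut at the `r`-th singular value has sensitivity `4 C √r` in Frobenius norm. -/
lemma norm_ofOp_softCut_sub_le (hC : 1 ≤ C) (r : Fin n) (hσ : Antitone σ) (hσ0 : ∀ i, 0 ≤ σ i)
    (hσ' : Antitone σ') (hσ0' : ∀ i, 0 ≤ σ' i)
    (h : ‖diagOp u σ v - diagOp u' σ' v'‖ ≤ 1) :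
    ‖ofOp (diagOp u (softCut C (σ r) ∘ σ) v) - ofOp (diagOp u' (softCut C (σ' r) ∘ σ') v')‖
      ≤ 4 * C * √r := by
  obtain ⟨_, h2⟩ := norm_sq_softCut_sub_le hC r hσ hσ0 hσ' hσ0' h
  refine le_of_sq_le_sq ?_ (by positivity)
  rw [← real_inner_self_eq_norm_sq, inner_eq_sum_inner_opOf u v', opOf_sub, opOf_ofOp, opOf_ofOp]
  simp only [← sq]
  refine h2.trans (le_of_eq ?_)
  rw [mul_pow, Real.sq_sqrt (Nat.cast_nonneg _)]
  ring

/-- The soft cut at the `r`-th singular value has sensitivity `6 C r` in nuclear norm. -/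
lemma inner_ofOp_softCut_sub_le (hC : 1 ≤ C) (r : Fin n) (hσ : Antitone σ) (hσ0 : ∀ i, 0 ≤ σ i)
    (hσ' : Antitone σ') (hσ0' : ∀ i, 0 ≤ σ' i)
    (h : ‖diagOp u σ v - diagOp u' σ' v'‖ ≤ 1) {w : EuclideanSpace ℝ (Fin n × Fin n)}
    (hw : ‖opOf w‖ ≤ 1) :
    ⟪w, ofOp (diagOp u (softCut C (σ r) ∘ σ) v) - ofOp (diagOp u' (softCut C (σ' r) ∘ σ') v')⟫_ℝ
      ≤ 6 * C * r := by
  obtain ⟨h1, h2⟩ := norm_sq_softCut_sub_le hC r hσ hσ0 hσ' hσ0' h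
  rw [inner_eq_sum_inner_opOf u v', opOf_sub, opOf_ofOp, opOf_ofOp]
  set Δ := diagOp u (softCut C (σ r) ∘ σ) v - diagOp u' (softCut C (σ' r) ∘ σ') v'
  have hsum := sum_sum_ite_le (g := fun i j ↦ ⟪u i, opOf w (v' j)⟫_ℝ ^ 2) (b := 1) r
    (fun i j ↦ sq_nonneg _) (fun i ↦ sum_sq_inner_apply_left_le v' hw (u.norm_eq_one i))
    (fun j ↦ sum_sq_inner_apply_right_le u hw (v'.norm_eq_one j))
  refine le_of_sq_le_sq ?_ (by positivity)
  -- Cauchy–Schwarz after restricting `w` to the rows and columns where `Δ` lives: `2r · 16C²r ≤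
  -- (6Cr)²`.
  have hcs := Finset.sum_mul_sq_le_sq_mul_sq (Finset.univ (α := Fin n × Fin n))
    (fun ij ↦ if ij.1 < r ∨ ij.2 < r then ⟪u ij.1, opOf w (v' ij.2)⟫_ℝ else 0)
    (fun ij ↦ ⟪u ij.1, Δ (v' ij.2)⟫_ℝ)
  rw [Fintype.sum_prod_type, Fintype.sum_prod_type, Fintype.sum_prod_type] at hcs
  simp only [ite_pow, ne_eq, OfNat.ofNat_ne_zero, not_false_eq_true, zero_pow] at hcs
  have heq : ∑ i, ∑ j, ⟪u i, opOf w (v' j)⟫_ℝ * ⟪u i, Δ (v' j)⟫_ℝ = ∑ i, ∑ j,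
      (if i < r ∨ j < r then ⟪u i, opOf w (v' j)⟫_ℝ else 0) * ⟪u i, Δ (v' j)⟫_ℝ := by
    refine Finset.sum_congr rfl fun i _ ↦ Finset.sum_congr rfl fun j _ ↦ ?_
    split_ifs with hij
    · rfl
    · rw [h1 i j hij]; simp
  rw [heq]
  refine hcs.trans ((mul_le_mul hsum h2 (by positivity) (by positivity)).trans ?_)
  have : 0 ≤ C ^ 2 * (r : ℝ) ^ 2 := by positivity
  nlinarith

end Sensitivity

/-! ### Additive noise with a given unnormalized density -/

section Normalize

variable {X : Type*} [MeasureSpace X] {p q : X → ℝ≥0∞}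

/-- The probability measure with the density proportional to `p`. -/
noncomputable def normalizedDensity (p : X → ℝ≥0∞) : Measure X :=
  (∫⁻ x, p x)⁻¹ • volume.withDensity p

lemma isProbabilityMeasure_normalizedDensity (h0 : ∫⁻ x, p x ≠ 0) (h1 : ∫⁻ x, p x ≠ ∞) :
    IsProbabilityMeasure (normalizedDensity p) := by
  constructor
  rw [normalizedDensity, Measure.smul_apply, withDensity_apply _ MeasurableSet.univ,
    Measure.restrict_univ, smul_eq_mul, ENNReal.inv_mul_cancel h0 h1]

lemma lintegral_normalizedDensity (hp : Measurable p) {g : X → ℝ≥0∞} (hg : Measurable g) :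
    ∫⁻ x, g x ∂normalizedDensity p = (∫⁻ x, p x)⁻¹ * ∫⁻ x, p x * g x := by
  rw [normalizedDensity, lintegral_smul_measure, lintegral_withDensity_eq_lintegral_mul _ hp hg,
    smul_eq_mul]
  rfl

lemma lintegral_normalizedDensity_le (hp : Measurable p) {g : X → ℝ≥0∞} (hg : Measurable g)
    {c : ℝ≥0∞} (h : ∫⁻ x, p x * g x ≤ c * ∫⁻ x, p x) : ∫⁻ x, g x ∂normalizedDensity p ≤ c := by
  rw [lintegral_normalizedDensity hp hg, mul_comm, ← div_eq_mul_inv]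
  exact ENNReal.div_le_of_le_mul h

lemma normalizedDensity_apply {s : Set X} (hs : MeasurableSet s) :
    normalizedDensity p s = (∫⁻ x, p x)⁻¹ * ∫⁻ x, s.indicator p x := by
  rw [normalizedDensity, Measure.smul_apply, withDensity_apply _ hs, smul_eq_mul,
    lintegral_indicator hs]

variable [AddCommGroup X] [MeasurableAdd X] [(volume : Measure X).IsAddRightInvariant]

/-- Additive noise is differentially private if its density is stable under shifts. -/
lemma normalizedDensity_preimage_add_le (hp : Measurable p) (h0 : ∫⁻ x, p x ≠ 0)
    (h1 : ∫⁻ x, p x ≠ ∞) {a a' : X} {c δ : ℝ≥0∞}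
    (h : ∀ x, p x ≤ c * p (x + (a - a')) + q x) (hq : ∫⁻ x, q x ≤ δ * ∫⁻ x, p x)
    {s : Set X} (hs : MeasurableSet s) :
    normalizedDensity p ((a + ·) ⁻¹' s)
      ≤ c * normalizedDensity p ((a' + ·) ⁻¹' s) + δ := by
  have hm (b : X) : MeasurableSet ((b + ·) ⁻¹' s) := measurable_const_add b hs
  rw [normalizedDensity_apply (hm a), normalizedDensity_apply (hm a')]
  set Z := ∫⁻ x, p x
  have hind : Measurable (((a' + ·) ⁻¹' s).indicator p) := hp.indicator (hm a')
  have key : ∫⁻ x, ((a + ·) ⁻¹' s).indicator p x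
      ≤ c * (∫⁻ x, ((a' + ·) ⁻¹' s).indicator p x) + δ * Z := by
    calc ∫⁻ x, ((a + ·) ⁻¹' s).indicator p x
        ≤ ∫⁻ x, (c * ((a' + ·) ⁻¹' s).indicator p (x + (a - a')) + q x) := by
          refine lintegral_mono fun x ↦ ?_
          by_cases hx : a + x ∈ s
          · have hx' : a' + (x + (a - a')) ∈ s := by
              have : a' + (x + (a - a')) = a + x := by abel
              rwa [this]
            rw [Set.indicator_of_mem (by exact hx), Set.indicator_of_mem (by exact hx')]
            exact h x
          · rw [Set.indicator_of_notMem (by exact hx)]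
            exact zero_le
      _ = c * (∫⁻ x, ((a' + ·) ⁻¹' s).indicator p x) + ∫⁻ x, q x := by
          have hind' : Measurable fun x ↦ ((a' + ·) ⁻¹' s).indicator p (x + (a - a')) :=
            hind.comp (measurable_add_const _)
          rw [lintegral_add_left (hind'.const_mul _), lintegral_const_mul _ hind',
            lintegral_add_right_eq_self (((a' + ·) ⁻¹' s).indicator p) (a - a')]
      _ ≤ _ := by gcongr
  calc Z⁻¹ * ∫⁻ x, ((a + ·) ⁻¹' s).indicator p x
      ≤ Z⁻¹ * (c * (∫⁻ x, ((a' + ·) ⁻¹' s).indicator p x) + δ * Z) := by gcongr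
    _ = c * (Z⁻¹ * ∫⁻ x, ((a' + ·) ⁻¹' s).indicator p x) + δ * (Z⁻¹ * Z) := by ring
    _ = _ := by rw [ENNReal.inv_mul_cancel h0 h1, mul_one]

end Normalize

/-! ### Gaussian noise -/

section Gaussian

/-- The density of a centered isotropic Gaussian with variance `s²`, up to normalization. -/
noncomputable def gaussDensity (V : Type*) [NormedAddCommGroup V] (s : ℝ) (x : V) : ℝ≥0∞ :=
  ENNReal.ofReal (Real.exp (-(‖x‖ ^ 2 / (2 * s ^ 2))))

lemma measurable_gaussDensity {V : Type*} [NormedAddCommGroup V] [MeasurableSpace V]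
    [BorelSpace V] {s : ℝ} : Measurable (gaussDensity V s) := by
  unfold gaussDensity
  fun_prop

variable {V : Type*} [NormedAddCommGroup V] [InnerProductSpace ℝ V] [FiniteDimensional ℝ V]
  [MeasurableSpace V] [BorelSpace V] {s : ℝ}

lemma lintegral_exp_ne_zero {f : V → ℝ} (hf : Measurable f) :
    ∫⁻ x, ENNReal.ofReal (Real.exp (f x)) ≠ 0 := by
  rw [Ne, lintegral_eq_zero_iff (by fun_prop)]
  intro h
  have : ∀ᵐ x : V, False := by
    filter_upwards [h] with x hx
    simp only [Pi.zero_apply, ENNReal.ofReal_eq_zero] at hx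
    exact absurd hx (not_le.2 (Real.exp_pos _))
  rw [Filter.eventually_false_iff_eq_bot, ae_eq_bot] at this
  exact NeZero.ne _ this

lemma lintegral_gaussDensity_ne_top (hs : 0 < s) : ∫⁻ x, gaussDensity V s x ≠ ∞ := by
  have h : Integrable fun x : V ↦ Real.exp (-(1 / (2 * s ^ 2)) * ‖x‖ ^ 2) := by
    apply Integrable.of_integral_ne_zero
    rw [GaussianFourier.integral_rexp_neg_mul_sq_norm (by positivity)]
    positivity
  refine ne_of_lt (lt_of_eq_of_lt ?_ h.lintegral_lt_top)
  refine lintegral_congr fun x ↦ ?_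
  rw [gaussDensity]
  ring_nf

/-- Completing the square: the exponential tilt is a translation by `s² h`. -/
lemma lintegral_gaussDensity_mul_exp_inner (hs : 0 < s) (h : V) (b : ℝ) :
    ∫⁻ x, gaussDensity V s x * ENNReal.ofReal (Real.exp (⟪h, x⟫_ℝ + b))
      = ENNReal.ofReal (Real.exp (s ^ 2 * ‖h‖ ^ 2 / 2 + b)) * ∫⁻ x, gaussDensity V s x := by
  rw [← lintegral_add_right_eq_self (gaussDensity V s) (-(s ^ 2 • h)),
    ← lintegral_const_mul' _ _ ENNReal.ofReal_ne_top]
  refine lintegral_congr fun x ↦ ?_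
  rw [gaussDensity, gaussDensity, ← ENNReal.ofReal_mul (Real.exp_pos _).le,
    ← ENNReal.ofReal_mul (Real.exp_pos _).le, ← Real.exp_add, ← Real.exp_add, ← sub_eq_add_neg x,
    norm_sub_sq_real, inner_smul_right, norm_smul, real_inner_comm, Real.norm_eq_abs, mul_pow,
    sq_abs]
  congr 2
  field_simp
  ring

/-- The Gaussian mechanism. -/
lemma gaussDensity_preimage_add_le {ε δ Δ : ℝ} (hε : 0 < ε) (hε1 : ε ≤ 1) (hδ : 0 < δ)
    (hδ1 : δ < 1 / 2) (hΔ : 0 < Δ) (hs : s = Δ * (2 * √(Real.log (1 / δ)) / ε)) {a a' : V}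
    (ha : ‖a - a'‖ ≤ Δ) {S : Set V} (hS : MeasurableSet S) :
    normalizedDensity (gaussDensity V s) ((a + ·) ⁻¹' S)
      ≤ ENNReal.ofReal (Real.exp ε) * normalizedDensity (gaussDensity V s) ((a' + ·) ⁻¹' S)
        + ENNReal.ofReal δ := by
  set l := Real.log (1 / δ) with hl
  have hl2 : 1 / 2 ≤ l := by
    have h1 : Real.log 2 ≤ l := Real.log_le_log (by norm_num) (by
      rw [le_div_iff₀ hδ]; linarith)
    linarith [Real.log_two_gt_d9]
  have hlδ : Real.exp (-l) = δ := by
    rw [hl, one_div, Real.log_inv, neg_neg, Real.exp_log hδ]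
  have hs0 : 0 < s := by
    rw [hs]; have : 0 < l := by linarith
    positivity
  have hs2 : s ^ 2 = Δ ^ 2 * (4 * l / ε ^ 2) := by
    rw [hs, mul_pow, div_pow, mul_pow, Real.sq_sqrt (by linarith)]; ring
  set d := a - a' with hd
  -- Chernoff exponent for the event that the privacy loss `L` below exceeds `ε`; the density `q`
  -- pays for that event.
  set μ := 3 * l / ε with hμ
  have hμ0 : 0 < μ := by positivity
  let q (x : V) : ℝ≥0∞ := gaussDensity V s x * ENNReal.ofReal (Real.exp
    (⟪(μ / s ^ 2) • d, x⟫_ℝ + (μ * ‖d‖ ^ 2 / (2 * s ^ 2) - μ * ε)))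
  refine normalizedDensity_preimage_add_le (q := q) measurable_gaussDensity
    (lintegral_exp_ne_zero (by fun_prop)) (lintegral_gaussDensity_ne_top hs0) ?_ ?_ hS
  · intro x
    set L := (2 * ⟪x, d⟫_ℝ + ‖d‖ ^ 2) / (2 * s ^ 2) with hL
    have h1 : gaussDensity V s (x + d)
        = gaussDensity V s x * ENNReal.ofReal (Real.exp (-L)) := by
      rw [gaussDensity, gaussDensity, ← ENNReal.ofReal_mul (Real.exp_pos _).le, ← Real.exp_add,
        norm_add_sq_real, hL]
      congr 2
      ring
    have h2 : q x = gaussDensity V s x * ENNReal.ofReal (Real.exp (μ * (L - ε))) := by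
      simp only [q]
      congr 3
      rw [inner_smul_left, real_inner_comm, hL]
      simp
      field_simp
      ring
    -- One of the two exponents is nonnegative, according to whether `L ≤ ε`.
    have h3 : (1 : ℝ≥0∞) ≤ ENNReal.ofReal (Real.exp (ε - L))
        + ENNReal.ofReal (Real.exp (μ * (L - ε))) := by
      rw [← ENNReal.ofReal_add (Real.exp_pos _).le (Real.exp_pos _).le, ENNReal.one_le_ofReal]
      rcases le_total L ε with h | h
      · linarith [Real.one_le_exp (sub_nonneg.2 h), Real.exp_pos (μ * (L - ε))]
      · linarith [Real.one_le_exp (mul_nonneg hμ0.le (sub_nonneg.2 h)), Real.exp_pos (ε - L)]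
    calc gaussDensity V s x
        ≤ gaussDensity V s x * (ENNReal.ofReal (Real.exp (ε - L))
          + ENNReal.ofReal (Real.exp (μ * (L - ε)))) := le_mul_of_one_le_right' h3
      _ = _ := by
        rw [h1, h2, mul_add, sub_eq_add_neg ε L, Real.exp_add,
          ENNReal.ofReal_mul (Real.exp_pos _).le]
        ring
  · simp only [q]
    rw [lintegral_gaussDensity_mul_exp_inner hs0]
    gcongr
    rw [← hlδ]
    apply Real.exp_le_exp.2
    have hd2 : ‖d‖ ^ 2 / s ^ 2 ≤ ε ^ 2 / (4 * l) := by
      have h1 : ‖d‖ ^ 2 ≤ Δ ^ 2 := by gcongr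
      rw [hs2, div_le_div_iff₀ (by positivity) (by positivity)]
      have : Δ ^ 2 * (4 * l / ε ^ 2) * ε ^ 2 = Δ ^ 2 * (4 * l) := by field_simp
      nlinarith
    have e1 : s ^ 2 * ‖(μ / s ^ 2) • d‖ ^ 2 / 2 + (μ * ‖d‖ ^ 2 / (2 * s ^ 2) - μ * ε)
        = (μ ^ 2 + μ) / 2 * (‖d‖ ^ 2 / s ^ 2) - μ * ε := by
      rw [norm_smul, mul_pow, Real.norm_eq_abs, sq_abs]
      field_simp
      ring
    rw [e1]
    have e2 : (μ ^ 2 + μ) / 2 * (‖d‖ ^ 2 / s ^ 2) ≤ (μ ^ 2 + μ) / 2 * (ε ^ 2 / (4 * l)) := by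
      gcongr
    -- The total exponent is at most `9l/8 + 3ε/8 - 3l`, which is at most `-l` because `ε ≤ 1` and
    -- `l ≥ 1/2`.
    have e3 : (μ ^ 2 + μ) / 2 * (ε ^ 2 / (4 * l)) = 9 * l / 8 + 3 * ε / 8 := by
      rw [hμ]; field_simp; ring
    have e4 : μ * ε = 3 * l := by rw [hμ]; field_simp
    linarith

end Gaussian

/-! ### Spectral norm of random matrices -/

section Tail

variable {n : ℕ}

lemma continuous_tensor :
    Continuous fun p : EuclideanSpace ℝ (Fin n) × EuclideanSpace ℝ (Fin n) ↦ tensor p.1 p.2 := by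
  unfold tensor
  fun_prop

/-- A tail bound for the operator norm of a random matrix whose bilinear forms have bounded
exponential moments. -/
lemma measure_le_norm_opOf_le [NeZero n] {ν : Measure (EuclideanSpace ℝ (Fin n × Fin n))}
    [IsProbabilityMeasure ν] {r t : ℝ} (hr : 0 ≤ r) {m : ℝ≥0∞}
    (hm : ∀ y z : EuclideanSpace ℝ (Fin n), ‖y‖ ≤ 1 → ‖z‖ ≤ 1 →
      ∫⁻ x, ENNReal.ofReal (Real.exp (r * ⟪tensor y z, x⟫_ℝ)) ∂ν ≤ m) :
    ν {x | t ≤ ‖opOf x‖} ≤ ENNReal.ofReal (16 ^ n * Real.exp (-(r * t / 8))) * m := by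
  set β : ℝ≥0∞ := volume (Metric.closedBall (0 : EuclideanSpace ℝ (Fin n)) 1) with hβ
  have hβ0 : β ≠ 0 := (Metric.measure_closedBall_pos volume _ one_pos).ne'
  have hβ1 : β ≠ ∞ := measure_closedBall_lt_top.ne
  -- In place of a net, the exponential of the bilinear form is averaged over all pairs in the unit
  -- balls. A matrix of large norm makes this average large, and Markov's inequality applies.
  set K : Set (EuclideanSpace ℝ (Fin n) × EuclideanSpace ℝ (Fin n)) := Metric.closedBall 0 1 ×ˢ Metric.closedBall 0 1 with hK
  have hKm : MeasurableSet K := measurableSet_closedBall.prod measurableSet_closedBall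
  let f (x : EuclideanSpace ℝ (Fin n × Fin n)) (p : EuclideanSpace ℝ (Fin n) × EuclideanSpace ℝ (Fin n)) : ℝ≥0∞ :=
    ENNReal.ofReal (Real.exp (r * ⟪tensor p.1 p.2, x⟫_ℝ))
  have hfc : Measurable (Function.uncurry f) := by
    have h1 : Continuous fun y : EuclideanSpace ℝ (Fin n × Fin n) × (EuclideanSpace ℝ (Fin n) × EuclideanSpace ℝ (Fin n)) ↦
        ENNReal.ofReal (Real.exp (r * ⟪tensor y.2.1 y.2.2, y.1⟫_ℝ)) := by
      have := (continuous_tensor (n := n)).comp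
        (continuous_snd (X := EuclideanSpace ℝ (Fin n × Fin n)))
      exact ENNReal.continuous_ofReal.comp (Real.continuous_exp.comp
        (continuous_const.mul (this.inner continuous_fst)))
    exact h1.measurable
  have hupper : ∫⁻ x, ∫⁻ p in K, f x p ∂(volume.prod volume) ∂ν ≤ m * (β * β) := by
    rw [lintegral_lintegral_swap hfc.aemeasurable]
    calc ∫⁻ p in K, ∫⁻ x, f x p ∂ν ∂(volume.prod volume)
        ≤ ∫⁻ p in K, m ∂(volume.prod volume) := by
          refine setLIntegral_mono' hKm fun p hp ↦ ?_
          exact hm p.1 p.2 (by simpa using hp.1) (by simpa using hp.2)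
      _ = m * (β * β) := by rw [setLIntegral_const, hK, Measure.prod_prod]
  set c := ENNReal.ofReal (Real.exp (r * t / 8)) * (ENNReal.ofReal ((1 / 4) ^ n) * β
    * (ENNReal.ofReal ((1 / 4) ^ n) * β)) with hc
  have hlower (x) (hx : t ≤ ‖opOf x‖) : c ≤ ∫⁻ p in K, f x p ∂(volume.prod volume) := by
    obtain ⟨u, v, huv⟩ := exists_eq_diagOp (opOf x)
    set d : Fin n → ℝ := fun i ↦ (opOf x).toLinearMap.singularValues i
    have hd0 : 0 ≤ d 0 := LinearMap.singularValues_nonneg _ _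
    have hle : ‖opOf x‖ ≤ d 0 := by
      rw [huv]
      refine norm_diagOp_le hd0 fun i ↦ ?_
      rw [abs_of_nonneg (LinearMap.singularValues_nonneg _ _)]
      exact LinearMap.singularValues_antitone _ (by simp)
    set u₀ : EuclideanSpace ℝ (Fin n) := u 0
    set v₀ : EuclideanSpace ℝ (Fin n) := v 0
    have hu₀ : ‖u₀‖ = 1 := u.norm_eq_one 0
    have hv₀ : ‖v₀‖ = 1 := v.norm_eq_one 0
    have huv₀ : opOf x v₀ = d 0 • u₀ := by
      conv_lhs => rw [huv]
      exact diagOp_apply_basis 0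
    -- Near the top singular pair, pulled inside the ball, the form stays at least `d 0 / 8`; these
    -- two balls fill a fraction `4⁻ⁿ` of the unit ball each, whence `16ⁿ`.
    have hsub : Metric.closedBall ((3 / 4 : ℝ) • u₀) (1 / 4) ×ˢ
        Metric.closedBall ((3 / 4 : ℝ) • v₀) (1 / 4) ⊆ K := by
      refine Set.prod_mono ?_ ?_ <;>
      · refine Metric.closedBall_subset_closedBall' ?_
        rw [dist_zero_right, norm_smul]
        first | rw [hu₀] | rw [hv₀]
        norm_num
    have hfin : Module.finrank ℝ (EuclideanSpace ℝ (Fin n)) = n := by simp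
    calc c = ∫⁻ p in Metric.closedBall ((3 / 4 : ℝ) • u₀) (1 / 4) ×ˢ
        Metric.closedBall ((3 / 4 : ℝ) • v₀) (1 / 4),
          ENNReal.ofReal (Real.exp (r * t / 8)) ∂(volume.prod volume) := by
          rw [setLIntegral_const, Measure.prod_prod, Measure.addHaar_closedBall' _ ((3 / 4 : ℝ) • u₀) (by norm_num),
            Measure.addHaar_closedBall' _ ((3 / 4 : ℝ) • v₀) (by norm_num), hfin, hc]
      _ ≤ ∫⁻ p in Metric.closedBall ((3 / 4 : ℝ) • u₀) (1 / 4) ×ˢ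
        Metric.closedBall ((3 / 4 : ℝ) • v₀) (1 / 4), f x p ∂(volume.prod volume) := by
          refine setLIntegral_mono' (measurableSet_closedBall.prod measurableSet_closedBall) ?_
          rintro ⟨y, z⟩ ⟨hy, hz⟩
          simp only [Metric.mem_closedBall, dist_eq_norm] at hy hz
          simp only [f]
          gcongr ENNReal.ofReal (Real.exp ?_)
          rw [mul_div_assoc]
          gcongr
          rw [real_inner_comm, inner_tensor]
          set a := y - (3 / 4 : ℝ) • u₀ with ha
          set b := z - (3 / 4 : ℝ) • v₀ with hb
          have hya : y = (3 / 4 : ℝ) • u₀ + a := by rw [ha]; abel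
          have hzb : z = (3 / 4 : ℝ) • v₀ + b := by rw [hb]; abel
          have h1 : ‖opOf x b‖ ≤ d 0 * (1 / 4) :=
            ((opOf x).le_of_opNorm_le hle b).trans (by gcongr)
          have h2 := neg_le_of_abs_le (abs_real_inner_le_norm a u₀)
          have h3 := neg_le_of_abs_le (abs_real_inner_le_norm u₀ (opOf x b))
          have h4 := neg_le_of_abs_le (abs_real_inner_le_norm a (opOf x b))
          have h5 : ‖a‖ * ‖opOf x b‖ ≤ 1 / 4 * (d 0 * (1 / 4)) := by gcongr
          rw [hu₀] at h2 h3
          -- The constant is `9/16 - 3/16 - 3/16 - 1/16 = 1/8`.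
          have e1 : ⟪y, opOf x z⟫_ℝ = 9 / 16 * d 0 + 3 / 4 * d 0 * ⟪a, u₀⟫_ℝ
              + 3 / 4 * ⟪u₀, opOf x b⟫_ℝ + ⟪a, opOf x b⟫_ℝ := by
            rw [hya, hzb]
            simp only [map_add, map_smul, inner_add_left, inner_add_right, inner_smul_left,
              inner_smul_right, huv₀, real_inner_self_eq_norm_sq, hu₀]
            simp
            ring
          have h6 : -(1 / 4) ≤ ⟪a, u₀⟫_ℝ := by linarith
          rw [e1]
          nlinarith [mul_le_mul_of_nonneg_left h6 hd0]
      _ ≤ _ := lintegral_mono_set hsub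
  have hG : Measurable fun x ↦ ∫⁻ p in K, f x p ∂(volume.prod volume) :=
    hfc.lintegral_prod_right'
  have hmark : c * ν {x | t ≤ ‖opOf x‖} ≤ m * (β * β) :=
    calc c * ν {x | t ≤ ‖opOf x‖}
        ≤ c * ν {x | c ≤ ∫⁻ p in K, f x p ∂(volume.prod volume)} := by
          gcongr with x
          exact hlower x
      _ ≤ _ := (mul_meas_ge_le_lintegral hG c).trans hupper
  have hββ0 : β * β ≠ 0 := mul_ne_zero hβ0 hβ0
  have hββ1 : β * β ≠ ∞ := ENNReal.mul_ne_top hβ1 hβ1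
  have hc' : ENNReal.ofReal (16 ^ n * Real.exp (-(r * t / 8))) * c = β * β := by
    rw [hc]
    calc _ = ENNReal.ofReal (16 ^ n * Real.exp (-(r * t / 8))) * ENNReal.ofReal (Real.exp (r * t / 8))
          * ENNReal.ofReal ((1 / 4) ^ n) * ENNReal.ofReal ((1 / 4) ^ n) * (β * β) := by ring
      _ = 1 * (β * β) := by
          rw [← ENNReal.ofReal_mul (by positivity), ← ENNReal.ofReal_mul (by positivity),
            ← ENNReal.ofReal_mul (by positivity), mul_assoc (16 ^ n), ← Real.exp_add,
            neg_add_cancel, Real.exp_zero, mul_one, ← mul_pow, ← mul_pow]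
          norm_num
      _ = β * β := one_mul _
  have hfinal := mul_le_mul_right hmark (ENNReal.ofReal (16 ^ n * Real.exp (-(r * t / 8))))
  rw [← mul_assoc, hc', ← mul_assoc, mul_comm (β * β)] at hfinal
  exact (ENNReal.mul_le_mul_iff_left hββ0 hββ1).1 hfinal

/-- If the exponential moments at `r` are at most `e²ⁿ`, the operator norm is `O(n / r)` with high
probability. -/
lemma measure_le_norm_opOf_le_rpow (hn : 1 ≤ n)
    {ν : Measure (EuclideanSpace ℝ (Fin n × Fin n))}
    [IsProbabilityMeasure ν] {r t a : ℝ} (hr : 0 ≤ r) (ha : 0 < a)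
    (hrt : r * t = 8 * (a + 5) * n)
    (hm : ∀ y z : EuclideanSpace ℝ (Fin n), ‖y‖ ≤ 1 → ‖z‖ ≤ 1 →
      ∫⁻ x, ENNReal.ofReal (Real.exp (r * ⟪tensor y z, x⟫_ℝ)) ∂ν
        ≤ ENNReal.ofReal (Real.exp (2 * n))) :
    ν {x | t ≤ ‖opOf x‖} ≤ ENNReal.ofReal ((n : ℝ) ^ (-a)) := by
  have : NeZero n := ⟨by omega⟩
  have hn0 : (0 : ℝ) < n := by exact_mod_cast hn
  refine (measure_le_norm_opOf_le hr hm).trans ?_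
  rw [← ENNReal.ofReal_mul (by positivity), hrt]
  apply ENNReal.ofReal_le_ofReal
  have h16 : (16 : ℝ) ^ n ≤ Real.exp (3 * n) := by
    have h1 : (16 : ℝ) ≤ Real.exp 3 := by
      have := Real.exp_one_gt_d9
      have h2 : Real.exp 3 = Real.exp 1 ^ 3 := by rw [← Real.exp_nat_mul]; norm_num
      rw [h2]
      calc (16 : ℝ) ≤ 2.7 ^ 3 := by norm_num
        _ ≤ _ := by gcongr; linarith
    rw [mul_comm, Real.exp_nat_mul]
    gcongr
  -- The `5` in `a + 5` absorbs `16ⁿ ≤ e³ⁿ` and the moment bound `e²ⁿ`.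
  calc 16 ^ n * Real.exp (-(8 * (a + 5) * n / 8)) * Real.exp (2 * n)
      ≤ Real.exp (3 * n) * Real.exp (-(8 * (a + 5) * n / 8)) * Real.exp (2 * n) := by gcongr
    _ = Real.exp (-a * n) := by rw [← Real.exp_add, ← Real.exp_add]; congr 1; ring
    _ ≤ (n : ℝ) ^ (-a) := by
      rw [Real.rpow_def_of_pos hn0, mul_comm]
      apply Real.exp_le_exp.2
      have := Real.log_le_self hn0.le
      nlinarith

end Tail

/-! ### Nuclear norm noise and exponential moments -/

section Nuclear

variable {n : ℕ} {x y w : EuclideanSpace ℝ (Fin n × Fin n)} {s b : ℝ}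

/-- The nuclear norm, as the dual norm of the operator norm. -/
noncomputable def nuclearNorm (x : EuclideanSpace ℝ (Fin n × Fin n)) : ℝ :=
  ⨆ w : {w : EuclideanSpace ℝ (Fin n × Fin n) // ‖opOf w‖ ≤ 1}, ⟪w.1, x⟫_ℝ

lemma norm_le_sqrt_of_norm_opOf_le (hw : ‖opOf w‖ ≤ 1) : ‖w‖ ≤ √n := by
  refine Real.le_sqrt_of_sq_le ?_
  have e := EuclideanSpace.basisFun (Fin n) ℝ
  rw [← real_inner_self_eq_norm_sq, inner_eq_sum_inner_opOf e e]
  calc ∑ i, ∑ j, ⟪e i, opOf w (e j)⟫_ℝ * ⟪e i, opOf w (e j)⟫_ℝ ≤ ∑ i : Fin n, (1 : ℝ) := by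
        refine Finset.sum_le_sum fun i _ ↦ ?_
        simpa only [sq] using sum_sq_inner_apply_left_le e hw (e.norm_eq_one i)
    _ = n := by simp

lemma nonempty_unitBall_opOf : Nonempty {w : EuclideanSpace ℝ (Fin n × Fin n) // ‖opOf w‖ ≤ 1} :=
  ⟨0, (norm_opOf_le 0).trans (by simp)⟩

lemma inner_le_nuclearNorm (hw : ‖opOf w‖ ≤ 1) : ⟪w, x⟫_ℝ ≤ nuclearNorm x := by
  refine le_ciSup (f := fun w : {w : EuclideanSpace ℝ (Fin n × Fin n) // ‖opOf w‖ ≤ 1} ↦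
    ⟪w.1, x⟫_ℝ) ⟨√n * ‖x‖, ?_⟩ ⟨w, hw⟩
  rintro _ ⟨⟨w, hw⟩, rfl⟩
  refine (real_inner_le_norm w x).trans ?_
  gcongr
  exact norm_le_sqrt_of_norm_opOf_le hw

lemma nuclearNorm_le (h : ∀ w, ‖opOf w‖ ≤ 1 → ⟪w, x⟫_ℝ ≤ b) : nuclearNorm x ≤ b :=
  have := nonempty_unitBall_opOf (n := n)
  ciSup_le fun w ↦ h w.1 w.2

lemma nuclearNorm_add_le : nuclearNorm (x + y) ≤ nuclearNorm x + nuclearNorm y :=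
  nuclearNorm_le fun w hw ↦ by
    rw [inner_add_right]
    exact add_le_add (inner_le_nuclearNorm hw) (inner_le_nuclearNorm hw)

lemma norm_le_nuclearNorm : ‖x‖ ≤ nuclearNorm x := by
  have h : ‖opOf (‖x‖⁻¹ • x)‖ ≤ 1 := by
    refine (norm_opOf_le _).trans ?_
    rw [norm_smul, norm_inv, norm_norm]
    exact inv_mul_le_one
  have h2 := inner_le_nuclearNorm (x := x) h
  rw [inner_smul_left, real_inner_self_eq_norm_sq] at h2
  refine le_trans (le_of_eq ?_) h2
  rcases eq_or_ne ‖x‖ 0 with h0 | h0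
  · simp [h0]
  · simp; field_simp

lemma measurable_nuclearNorm : Measurable (nuclearNorm (n := n)) := by
  refine (LipschitzWith.of_le_add_mul (Real.toNNReal √n) fun x y ↦ ?_).continuous.measurable
  rw [Real.coe_toNNReal _ (Real.sqrt_nonneg _), dist_eq_norm]
  refine nuclearNorm_le fun w hw ↦ ?_
  have h : ⟪w, x⟫_ℝ = ⟪w, y⟫_ℝ + ⟪w, x - y⟫_ℝ := by rw [inner_sub_right]; ring
  rw [h]
  refine add_le_add (inner_le_nuclearNorm hw) ((real_inner_le_norm _ _).trans ?_)
  gcongr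
  exact norm_le_sqrt_of_norm_opOf_le hw

/-- The density `exp (-‖x‖₁ / s)` for the nuclear norm `‖·‖₁`, up to normalization. -/
noncomputable def nuclearDensity (n : ℕ) (s : ℝ) (x : EuclideanSpace ℝ (Fin n × Fin n)) : ℝ≥0∞ :=
  ENNReal.ofReal (Real.exp (-(nuclearNorm x / s)))

lemma measurable_nuclearDensity : Measurable (nuclearDensity n s) := by
  have := measurable_nuclearNorm (n := n)
  unfold nuclearDensity
  fun_prop

lemma lintegral_nuclearDensity_ne_zero : ∫⁻ x, nuclearDensity n s x ≠ 0 :=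
  have := measurable_nuclearNorm (n := n)
  lintegral_exp_ne_zero (by fun_prop)

/-- The nuclear norm dominates the Frobenius norm, and exponential decay beats the power of `1 +
‖x‖` needed for integrability. -/
lemma lintegral_nuclearDensity_ne_top (hs : 0 < s) : ∫⁻ x, nuclearDensity n s x ≠ ∞ := by
  set N := Module.finrank ℝ (EuclideanSpace ℝ (Fin n × Fin n)) + 1 with hN
  have hint : Integrable fun x : EuclideanSpace ℝ (Fin n × Fin n) ↦
      s ^ N * N.factorial * Real.exp (1 / s) * (1 + ‖x‖) ^ (-(N : ℝ)) :=
    (integrable_one_add_norm (by rw [hN]; push_cast; linarith)).const_mul _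
  refine ne_of_lt (lt_of_le_of_lt (lintegral_mono fun x ↦ ?_) hint.lintegral_lt_top)
  rw [nuclearDensity]
  apply ENNReal.ofReal_le_ofReal
  have hx : 0 < 1 + ‖x‖ := by positivity
  have h1 := Real.pow_div_factorial_le_exp ((1 + ‖x‖) / s) (by positivity) N
  have h2 : Real.exp (-(nuclearNorm x / s)) ≤ Real.exp (-(‖x‖ / s)) := by
    gcongr
    exact norm_le_nuclearNorm
  refine h2.trans ?_
  rw [Real.rpow_neg hx.le, Real.rpow_natCast, ← div_eq_mul_inv, le_div_iff₀ (by positivity)]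
  rw [div_pow, div_div, div_le_iff₀ (by positivity)] at h1
  calc Real.exp (-(‖x‖ / s)) * (1 + ‖x‖) ^ N
      ≤ Real.exp (-(‖x‖ / s)) * (Real.exp ((1 + ‖x‖) / s) * (s ^ N * N.factorial)) := by gcongr
    _ = Real.exp (-(‖x‖ / s)) * Real.exp ((1 + ‖x‖) / s) * (s ^ N * N.factorial) := by ring
    _ = _ := by
      rw [← Real.exp_add, show -(‖x‖ / s) + (1 + ‖x‖) / s = 1 / s by ring]
      ring

/-- The nuclear norm mechanism. -/
lemma nuclearDensity_preimage_add_le {ε Δ : ℝ} (hΔ : 0 < Δ) (hε : 0 < ε) (hs : s = Δ / ε)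
    {a a' : EuclideanSpace ℝ (Fin n × Fin n)}
    (ha : ∀ w, ‖opOf w‖ ≤ 1 → ⟪w, a - a'⟫_ℝ ≤ Δ)
    {S : Set (EuclideanSpace ℝ (Fin n × Fin n))} (hS : MeasurableSet S) :
    normalizedDensity (nuclearDensity n s) ((a + ·) ⁻¹' S)
      ≤ ENNReal.ofReal (Real.exp ε) * normalizedDensity (nuclearDensity n s) ((a' + ·) ⁻¹' S)
        + ENNReal.ofReal 0 := by
  have hs0 : 0 < s := by rw [hs]; positivity
  refine normalizedDensity_preimage_add_le (q := 0) measurable_nuclearDensity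
    lintegral_nuclearDensity_ne_zero (lintegral_nuclearDensity_ne_top hs0) (fun x ↦ ?_)
    (by simp) hS
  rw [nuclearDensity, nuclearDensity, Pi.zero_apply, add_zero,
    ← ENNReal.ofReal_mul (Real.exp_pos _).le, ← Real.exp_add]
  gcongr
  have h1 : nuclearNorm (x + (a - a')) ≤ nuclearNorm x + Δ :=
    nuclearNorm_add_le.trans (by gcongr; exact nuclearNorm_le ha)
  have h2 : nuclearNorm (x + (a - a')) / s ≤ (nuclearNorm x + Δ) / s := by gcongr
  rw [add_div, show Δ / s = ε by rw [hs]; field_simp] at h2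
  linarith

/-- The matrix that halves the direction `u`, if `u` is a unit vector. -/
noncomputable def halving (u : EuclideanSpace ℝ (Fin n)) : Matrix (Fin n) (Fin n) ℝ :=
  1 - (1 / 2 : ℝ) • Matrix.vecMulVec u u

lemma det_halving (u : EuclideanSpace ℝ (Fin n)) : (halving u).det = 1 - ‖u‖ ^ 2 / 2 := by
  have h : halving u = 1 + Matrix.replicateCol Unit (-(1 / 2 : ℝ) • u.ofLp)
      * Matrix.replicateRow Unit u.ofLp := by
    ext i j
    simp [halving, Matrix.vecMulVec_apply, Matrix.mul_apply]
    ring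
  rw [h, Matrix.det_one_add_replicateCol_mul_replicateRow, EuclideanSpace.real_norm_sq_eq]
  simp [dotProduct, Finset.sum_div, ← sub_eq_add_neg]
  refine Finset.sum_congr rfl fun i _ ↦ ?_
  ring

lemma halving_mulVec (u y : EuclideanSpace ℝ (Fin n)) :
    WithLp.toLp 2 (Matrix.mulVec (halving u) y) = y - ((1 / 2 : ℝ) * ⟪u, y⟫_ℝ) • u := by
  ext i
  have h : ⟪u, y⟫_ℝ = u.ofLp ⬝ᵥ y.ofLp := by
    simp [PiLp.inner_apply, dotProduct, mul_comm]
  simp [halving, Matrix.sub_mulVec, Matrix.smul_mulVec, Matrix.vecMulVec_mulVec, h]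
  ring

lemma norm_sq_halving_le {u : EuclideanSpace ℝ (Fin n)} (hu : ‖u‖ ≤ 1)
    (y : EuclideanSpace ℝ (Fin n)) :
    ‖y - ((1 / 2 : ℝ) * ⟪u, y⟫_ℝ) • u‖ ^ 2 ≤ ‖y‖ ^ 2 - 3 / 4 * ⟪u, y⟫_ℝ ^ 2 := by
  rw [norm_sub_sq_real, inner_smul_right, real_inner_comm, norm_smul, mul_pow, Real.norm_eq_abs,
    sq_abs]
  have h1 : ‖u‖ ^ 2 ≤ 1 := pow_le_one₀ (norm_nonneg _) hu
  nlinarith [mul_le_mul_of_nonneg_left h1 (sq_nonneg ⟪u, y⟫_ℝ)]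

lemma norm_opOf_le_one (h : ∀ y z, ⟪w, tensor y z⟫_ℝ ≤ ‖y‖ * ‖z‖) : ‖opOf w‖ ≤ 1 := by
  refine ContinuousLinearMap.opNorm_le_bound _ zero_le_one fun z ↦ ?_
  have h1 := h (opOf w z) z
  rw [inner_tensor, real_inner_self_eq_norm_sq] at h1
  rcases (norm_nonneg (opOf w z)).eq_or_lt with h0 | h0
  · rw [← h0]; positivity
  · refine le_of_mul_le_mul_left ?_ h0
    linarith

/-- Halving the directions `u` and `v` on both sides of a matrix. -/
noncomputable def halvingBoth (u v : EuclideanSpace ℝ (Fin n)) :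
    EuclideanSpace ℝ (Fin n × Fin n) →ₗ[ℝ] EuclideanSpace ℝ (Fin n × Fin n) :=
  Matrix.toEuclideanLin (Matrix.kroneckerMap (· * ·) (halving u) (halving v))

lemma det_halvingBoth (u v : EuclideanSpace ℝ (Fin n)) :
    LinearMap.det (halvingBoth u v) = (1 - ‖u‖ ^ 2 / 2) ^ n * (1 - ‖v‖ ^ 2 / 2) ^ n := by
  rw [halvingBoth, Matrix.toEuclideanLin_eq_toLin_orthonormal, LinearMap.det_toLin,
    Matrix.det_kronecker, det_halving, det_halving, Fintype.card_fin]

lemma inner_halvingBoth (u v : EuclideanSpace ℝ (Fin n)) :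
    ⟪w, halvingBoth u v x⟫_ℝ = ⟪halvingBoth u v w, x⟫_ℝ := by
  have h : (Matrix.kroneckerMap (· * ·) (halving u) (halving v)).conjTranspose
      = Matrix.kroneckerMap (· * ·) (halving u) (halving v) := by
    ext ⟨i, j⟩ ⟨k, l⟩
    simp [Matrix.kroneckerMap_apply, halving, Matrix.vecMulVec_apply, Matrix.one_apply, eq_comm,
      mul_comm]
  rw [← LinearMap.adjoint_inner_left, halvingBoth, ← Matrix.toEuclideanLin_conjTranspose_eq_adjoint,
    h]

lemma halvingBoth_tensor (u v y z : EuclideanSpace ℝ (Fin n)) :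
    halvingBoth u v (tensor y z)
      = tensor (y - ((1 / 2 : ℝ) * ⟪u, y⟫_ℝ) • u) (z - ((1 / 2 : ℝ) * ⟪v, z⟫_ℝ) • v) := by
  rw [← halving_mulVec, ← halving_mulVec]
  ext ⟨i, j⟩
  simp only [halvingBoth, tensor, Matrix.toLpLin_apply, Matrix.mulVec, dotProduct,
    Fintype.sum_prod_type, Finset.sum_mul_sum]
  refine Finset.sum_congr rfl fun k _ ↦ Finset.sum_congr rfl fun l _ ↦ ?_
  simp [Matrix.kroneckerMap_apply]
  ring

/-- By duality it suffices that halving `w` on both sides leaves room to add `3/4` of `tensor u v`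
within the unit ball of the operator norm. Halving lowers `‖y‖²` by `3/4 ⟪u, y⟫²` (as `1 - (1/2)² =
3/4`), and similarly for `z`; the product is then bounded by AM-GM. -/
lemma nuclearNorm_halvingBoth_le {u v : EuclideanSpace ℝ (Fin n)} (hu : ‖u‖ ≤ 1) (hv : ‖v‖ ≤ 1) :
    nuclearNorm (halvingBoth u v x) ≤ nuclearNorm x - 3 / 4 * ⟪tensor u v, x⟫_ℝ := by
  refine nuclearNorm_le fun w hw ↦ ?_
  have hw' : ‖opOf (halvingBoth u v w + (3 / 4 : ℝ) • tensor u v)‖ ≤ 1 := by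
    refine norm_opOf_le_one fun y z ↦ ?_
    rw [inner_add_left, inner_smul_left, inner_tensor_tensor, ← inner_halvingBoth,
      halvingBoth_tensor, inner_tensor]
    set a := ⟪u, y⟫_ℝ
    set b := ⟪v, z⟫_ℝ
    have hy := norm_sq_halving_le hu y
    have hz := norm_sq_halving_le hv z
    set y' := y - ((1 / 2 : ℝ) * ⟪u, y⟫_ℝ) • u
    set z' := z - ((1 / 2 : ℝ) * ⟪v, z⟫_ℝ) • v
    have ha : |a| ≤ ‖y‖ := (abs_real_inner_le_norm u y).trans
      (mul_le_of_le_one_left (norm_nonneg _) hu)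
    have hb : |b| ≤ ‖z‖ := (abs_real_inner_le_norm v z).trans
      (mul_le_of_le_one_left (norm_nonneg _) hv)
    have hab : a * b ≤ ‖y‖ * ‖z‖ := (le_abs_self _).trans (by rw [abs_mul]; gcongr)
    have h1 : ⟪y', opOf w z'⟫_ℝ ≤ ‖y'‖ * ‖z'‖ := by
      refine (real_inner_le_norm _ _).trans ?_
      gcongr
      simpa using (opOf w).le_of_opNorm_le hw z'
    have h2 : ‖y'‖ * ‖z'‖ ≤ ‖y‖ * ‖z‖ - 3 / 4 * (a * b) := by
      have h0 : 0 ≤ ‖y‖ * ‖z‖ := by positivity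
      refine le_of_sq_le_sq ?_ (by linarith)
      rw [mul_pow]
      have h3 : ‖y'‖ ^ 2 * ‖z'‖ ^ 2 ≤ (‖y‖ ^ 2 - 3 / 4 * a ^ 2) * (‖z‖ ^ 2 - 3 / 4 * b ^ 2) :=
        mul_le_mul hy hz (by positivity) ((sq_nonneg _).trans hy)
      nlinarith [sq_nonneg (‖y‖ * b - ‖z‖ * a)]
    simp only [conj_trivial]
    linarith
  have h := inner_le_nuclearNorm (x := x) hw'
  rw [inner_add_left, inner_smul_left, ← inner_halvingBoth] at h
  simp only [conj_trivial] at h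
  linarith

/-- Exponential moments of the bilinear forms of nuclear noise. -/
lemma lintegral_exp_inner_tensor_nuclearDensity_le (hs : 0 < s) {u v : EuclideanSpace ℝ (Fin n)}
    (hu : ‖u‖ ≤ 1) (hv : ‖v‖ ≤ 1) :
    ∫⁻ x, ENNReal.ofReal (Real.exp (3 / (4 * s) * ⟪tensor u v, x⟫_ℝ))
        ∂normalizedDensity (nuclearDensity n s) ≤ ENNReal.ofReal (Real.exp (2 * n)) := by
  refine lintegral_normalizedDensity_le measurable_nuclearDensity (by fun_prop) ?_
  have hu2 : ‖u‖ ^ 2 ≤ 1 := pow_le_one₀ (norm_nonneg _) hu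
  have hv2 : ‖v‖ ^ 2 ≤ 1 := pow_le_one₀ (norm_nonneg _) hv
  have hdet : (1 / 4 : ℝ) ^ n ≤ LinearMap.det (halvingBoth u v) := by
    rw [det_halvingBoth, ← mul_pow]
    gcongr
    nlinarith
  have hdet0 : LinearMap.det (halvingBoth u v) ≠ 0 := by
    have : (0 : ℝ) < (1 / 4) ^ n := by positivity
    linarith
  have hmeas : Measurable (halvingBoth u v) :=
    (halvingBoth u v).continuous_of_finiteDimensional.measurable
  -- The tilt is absorbed by the linear substitution `halvingBoth u v`, whose determinant is at
  -- least `4⁻ⁿ`; finally `4 ≤ e²`.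
  calc ∫⁻ x, nuclearDensity n s x * ENNReal.ofReal (Real.exp (3 / (4 * s) * ⟪tensor u v, x⟫_ℝ))
      ≤ ∫⁻ x, nuclearDensity n s (halvingBoth u v x) := by
        refine lintegral_mono fun x ↦ ?_
        rw [nuclearDensity, nuclearDensity, ← ENNReal.ofReal_mul (Real.exp_pos _).le,
          ← Real.exp_add]
        gcongr
        have h := div_le_div_of_nonneg_right (nuclearNorm_halvingBoth_le (x := x) hu hv) hs.le
        rw [sub_div, show 3 / 4 * ⟪tensor u v, x⟫_ℝ / s = 3 / (4 * s) * ⟪tensor u v, x⟫_ℝ by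
          field_simp] at h
        linarith
    _ = ∫⁻ x, nuclearDensity n s x ∂(Measure.map (halvingBoth u v) volume) := by
        rw [lintegral_map measurable_nuclearDensity hmeas]
    _ = ENNReal.ofReal |(LinearMap.det (halvingBoth u v))⁻¹| * ∫⁻ x, nuclearDensity n s x := by
        rw [Measure.map_linearMap_addHaar_eq_smul_addHaar _ hdet0, lintegral_smul_measure,
          smul_eq_mul]
    _ ≤ _ := by
        gcongr
        have hpos : (0 : ℝ) < (1 / 4) ^ n := by positivity
        rw [abs_of_pos (inv_pos.2 (hpos.trans_le hdet))]
        refine (inv_anti₀ hpos hdet).trans ?_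
        rw [← inv_pow, mul_comm, Real.exp_nat_mul]
        gcongr
        have := Real.exp_one_gt_d9
        have h2 : Real.exp 2 = Real.exp 1 ^ 2 := by rw [← Real.exp_nat_mul]; norm_num
        rw [h2]
        nlinarith

/-- Exponential moments of the bilinear forms of Gaussian noise. -/
lemma lintegral_exp_inner_tensor_gaussDensity_le (hs : 0 < s) {u v : EuclideanSpace ℝ (Fin n)}
    (hu : ‖u‖ ≤ 1) (hv : ‖v‖ ≤ 1) :
    ∫⁻ x, ENNReal.ofReal (Real.exp (√n / s * ⟪tensor u v, x⟫_ℝ))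
        ∂normalizedDensity (gaussDensity (EuclideanSpace ℝ (Fin n × Fin n)) s)
      ≤ ENNReal.ofReal (Real.exp (2 * n)) := by
  refine lintegral_normalizedDensity_le measurable_gaussDensity (by fun_prop) ?_
  have h := lintegral_gaussDensity_mul_exp_inner hs ((√n / s) • tensor u v) 0
  simp only [add_zero, inner_smul_left, conj_trivial] at h
  rw [h]
  gcongr
  rw [norm_smul, norm_tensor, mul_pow, Real.norm_eq_abs, sq_abs, div_pow,
    Real.sq_sqrt (Nat.cast_nonneg _), mul_pow]
  have h1 : s ^ 2 * (n / s ^ 2 * (‖u‖ ^ 2 * ‖v‖ ^ 2)) / 2 = n * (‖u‖ ^ 2 * ‖v‖ ^ 2) / 2 := by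
    field_simp
  rw [h1]
  have h2 : ‖u‖ ^ 2 * ‖v‖ ^ 2 ≤ 1 := mul_le_one₀ (pow_le_one₀ (norm_nonneg _) hu) (sq_nonneg _)
    (pow_le_one₀ (norm_nonneg _) hv)
  have h3 : (n : ℝ) * (‖u‖ ^ 2 * ‖v‖ ^ 2) ≤ n * 1 := by gcongr
  linarith [(Nat.cast_nonneg n : (0 : ℝ) ≤ n)]

end Nuclear

/-! ### The private algorithm: cut, add noise, round, truncate -/

section Mechanism

variable {n k : ℕ}

instance (n : ℕ) : MeasurableSingletonClass (Matrix (Fin n) (Fin n) ℝ) :=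
  inferInstanceAs (MeasurableSingletonClass (Fin n → Fin n → ℝ))

lemma rank_le_of_eq_diagOp {p q : OrthonormalBasis (Fin n) ℝ (EuclideanSpace ℝ (Fin n))}
    {s : Fin n → ℝ} {B : Matrix (Fin n) (Fin n) ℝ}
    (h : Matrix.toEuclideanCLM (n := Fin n) (𝕜 := ℝ) B
      = diagOp p (fun i ↦ if (i : ℕ) < k then s i else 0) q) : B.rank ≤ k := by
  rw [Matrix.rank_eq_finrank_range_toLin B (EuclideanSpace.basisFun (Fin n) ℝ).toBasis
    (EuclideanSpace.basisFun (Fin n) ℝ).toBasis, ← Matrix.toEuclideanLin_eq_toLin_orthonormal,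
    ← Matrix.coe_toEuclideanCLM_eq_toEuclideanLin, h]
  classical
  set t : Finset (EuclideanSpace ℝ (Fin n)) := (Finset.univ.filter fun i : Fin n ↦ (i : ℕ) < k).image p
  have hle : LinearMap.range (diagOp p (fun i ↦ if (i : ℕ) < k then s i else 0) q).toLinearMap
      ≤ Submodule.span ℝ (t : Set (EuclideanSpace ℝ (Fin n))) := by
    rintro _ ⟨x, rfl⟩
    change diagOp p _ q x ∈ _
    rw [diagOp_apply]
    refine Submodule.sum_mem _ fun i _ ↦ ?_
    split_ifs with hi
    · exact Submodule.smul_mem _ _ (Submodule.subset_span (by simpa [t] using ⟨i, hi, rfl⟩))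
    · simp
  refine (Submodule.finrank_mono hle).trans ((finrank_span_finset_le_card t).trans ?_)
  refine Finset.card_image_le.trans ?_
  have : (Finset.univ.filter fun i : Fin n ↦ (i : ℕ) < k).card ≤ (Finset.range k).card :=
    Finset.card_le_card_of_injOn (fun i ↦ (i : ℕ)) (by intro i hi; simpa using hi)
      (Fin.val_injective.injOn)
  simpa using this

/-- A measurable choice of a rank-`k` truncation of a nearby matrix: rounding to a grid leaves
countably many matrices to be truncated. -/
lemma exists_measurable_truncation (hn : 0 < n) (k : ℕ) {h : ℝ} (hh : 0 < h) :
    ∃ G : EuclideanSpace ℝ (Fin n × Fin n) → Matrix (Fin n) (Fin n) ℝ, Measurable G ∧ (Set.range G).Countable ∧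
      ∀ x, ∃ p q s, Antitone s ∧ (∀ i, 0 ≤ s i) ∧ ‖diagOp p s q - opOf x‖ ≤ h ∧
        Matrix.toEuclideanCLM (n := Fin n) (𝕜 := ℝ) (G x)
          = diagOp p (fun i ↦ if (i : ℕ) < k then s i else 0) q := by
  have hn0 : (0 : ℝ) < n := by exact_mod_cast hn
  -- Mesh `h / n`: the `n²` entries each err by at most `h / n`, so the Frobenius error is at most
  -- `h`.
  let pt (z : Fin n × Fin n → ℤ) : EuclideanSpace ℝ (Fin n × Fin n) :=
    WithLp.toLp 2 fun ij ↦ h / n * z ij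
  choose p q hpq using fun z ↦ exists_eq_diagOp (opOf (pt z))
  let s (z) (i : Fin n) : ℝ := (opOf (pt z)).toLinearMap.singularValues i
  let fl (x : EuclideanSpace ℝ (Fin n × Fin n)) (ij : Fin n × Fin n) : ℤ := ⌊x ij / (h / n)⌋
  have hfl : Measurable fl := measurable_pi_lambda _ fun ij ↦ by fun_prop
  let g (z : Fin n × Fin n → ℤ) : Matrix (Fin n) (Fin n) ℝ :=
    (Matrix.toEuclideanCLM (n := Fin n) (𝕜 := ℝ)).symm
      (diagOp (p z) (fun i ↦ if (i : ℕ) < k then s z i else 0) (q z))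
  refine ⟨g ∘ fl, (measurable_of_countable g).comp hfl,
    (Set.countable_range g).mono (Set.range_comp_subset_range fl g), fun x ↦
    ⟨p (fl x), q (fl x), s (fl x), fun i j hij ↦ LinearMap.singularValues_antitone _ hij,
      fun i ↦ LinearMap.singularValues_nonneg _ _, ?_, by simp [g]⟩⟩
  rw [← hpq, ← opOf_sub]
  refine (norm_opOf_le _).trans (le_of_sq_le_sq ?_ hh.le)
  rw [EuclideanSpace.real_norm_sq_eq]
  calc ∑ ij, (pt (fl x) - x) ij ^ 2 ≤ ∑ ij : Fin n × Fin n, (h / n) ^ 2 := by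
        refine Finset.sum_le_sum fun ij _ ↦ ?_
        have hη : 0 < h / n := by positivity
        have h1 := Int.floor_le (x ij / (h / n))
        have h2 := Int.lt_floor_add_one (x ij / (h / n))
        rw [le_div_iff₀ hη] at h1
        rw [div_lt_iff₀ hη] at h2
        simp only [PiLp.sub_apply, pt, fl]
        rw [sq_le_sq, abs_of_pos hη, abs_le]
        constructor <;> linarith
    _ = h ^ 2 := by
        simp
        field_simp

lemma ApproximatesRank.mono {γ Γ e e' P : ℝ}
    {M : RandomizedAlgorithm (Matrix (Fin n) (Fin n) ℝ) (Matrix (Fin n) (Fin n) ℝ)}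
    (h : ApproximatesRank γ Γ k e P M) (hee : e ≤ e') : ApproximatesRank γ Γ k e' P M :=
  ⟨h.1, fun A hA ↦ (h.2 A hA).trans (measure_mono fun _ hB ↦
    le_trans (Set.mem_ofPred_eq.mp hB) (by gcongr))⟩

/-- Adding noise to the soft cut at the `r`-th singular value and truncating to rank `k`. -/
lemma exists_mechanism {γ Γ ε δ P t : ℝ} (hγ : 0 < γ) (hγ1 : γ < 1) (hk : 1 ≤ k) (r : Fin n)
    (hkr : k ≤ r) (hr : ∀ c : ℕ, c ≤ n → (c : ℝ) ≤ Γ * k → c ≤ r + 1)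
    (ν : Measure (EuclideanSpace ℝ (Fin n × Fin n))) [IsProbabilityMeasure ν] (ht : 0 < t)
    (htail : ν {x | t ≤ ‖opOf x‖} ≤ ENNReal.ofReal P) (hP : 0 ≤ P)
    (hDP : ∀ a a' : EuclideanSpace ℝ (Fin n × Fin n), ‖a - a'‖ ≤ 4 * (2 / γ) * √r →
      (∀ w, ‖opOf w‖ ≤ 1 → ⟪w, a - a'⟫_ℝ ≤ 6 * (2 / γ) * r) → ∀ S, MeasurableSet S →
      ν ((a + ·) ⁻¹' S) ≤ ENNReal.ofReal (Real.exp ε) * ν ((a' + ·) ⁻¹' S) + ENNReal.ofReal δ) :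
    ∃ M : RandomizedAlgorithm (Matrix (Fin n) (Fin n) ℝ) (Matrix (Fin n) (Fin n) ℝ),
      IsDifferentiallyPrivate SpectralNeighbors ε δ M ∧
      ApproximatesRank γ Γ k (52 / γ * t) P M := by
  have hC : 1 ≤ 2 / γ := by rw [le_div_iff₀ hγ]; linarith
  have hC0 : 0 ≤ 2 / γ := by linarith
  obtain ⟨G, hG, hGc, hGx⟩ := exists_measurable_truncation r.pos k ht
  let sv (A : Matrix (Fin n) (Fin n) ℝ) (i : Fin n) : ℝ :=
    (Matrix.toEuclideanLin A).singularValues i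
  have hsv (A) : Antitone (sv A) := fun i j hij ↦ LinearMap.singularValues_antitone _ hij
  have hsv0 (A i) : 0 ≤ sv A i := LinearMap.singularValues_nonneg _ _
  have hsvd (A : Matrix (Fin n) (Fin n) ℝ) :
      ∃ u v, Matrix.toEuclideanCLM (n := Fin n) (𝕜 := ℝ) A = diagOp u (sv A) v := by
    obtain ⟨u, v, h⟩ := exists_eq_diagOp (Matrix.toEuclideanCLM (n := Fin n) (𝕜 := ℝ) A)
    exact ⟨u, v, h⟩
  choose u v huv using hsvd
  let F (A : Matrix (Fin n) (Fin n) ℝ) : EuclideanSpace ℝ (Fin n × Fin n) :=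
    ofOp (diagOp (u A) (softCut (2 / γ) (sv A r) ∘ sv A) (v A))
  have hm (A) : Measurable fun x ↦ G (F A + x) := hG.comp (measurable_const_add _)
  have hprob (A) : IsProbabilityMeasure (ν.map fun x ↦ G (F A + x)) :=
    Measure.isProbabilityMeasure_map (hm A).aemeasurable
  refine ⟨fun A ↦ ⟨ν.map fun x ↦ G (F A + x), hprob A⟩, ?_, ?_, ?_⟩
  · intro A A' hAA S hS
    have hn : ‖diagOp (u A) (sv A) (v A) - diagOp (u A') (sv A') (v A')‖ ≤ 1 := by
      rw [← huv, ← huv, ← map_sub]; exact hAA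
    have := hDP (F A) (F A')
      (norm_ofOp_softCut_sub_le hC r (hsv A) (hsv0 A) (hsv A') (hsv0 A') hn)
      (fun w hw ↦ inner_ofOp_softCut_sub_le hC r (hsv A) (hsv0 A) (hsv A') (hsv0 A') hn hw)
      (G ⁻¹' S) (hG hS)
    change (ν.map fun x ↦ G (F A + x)) S
      ≤ ENNReal.ofReal (Real.exp ε) * (ν.map fun x ↦ G (F A' + x)) S + ENNReal.ofReal δ
    rw [Measure.map_apply (hm A) hS, Measure.map_apply (hm A') hS]
    exact this
  · intro A
    change ∀ᵐ B ∂(ν.map fun x ↦ G (F A + x)), B.rank ≤ k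
    have hrank (x) : (G x).rank ≤ k := by
      obtain ⟨p, q, s, -, -, -, h⟩ := hGx x
      exact rank_le_of_eq_diagOp h
    -- The output lies in a countable, hence measurable, set; measurability of the rank condition is
    -- never needed.
    have hae : ∀ᵐ B ∂(ν.map fun x ↦ G (F A + x)), B ∈ Set.range G :=
      (ae_map_iff (hm A).aemeasurable hGc.measurableSet).2 (by simp)
    filter_upwards [hae]
    rintro _ ⟨x, rfl⟩
    exact hrank x
  · rintro A ⟨c, hkc, hcn, hcΓ, hc⟩
    change _ ≤ (ν.map fun x ↦ G (F A + x)) _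
    refine le_trans ?_ (Measure.le_map_apply (hm A).aemeasurable _)
    have hcr := hr c hcn hcΓ
    have h1 : ENNReal.ofReal (1 - P) ≤ ν {x | t ≤ ‖opOf x‖}ᶜ := by
      have h2 : 1 ≤ ν {x | t ≤ ‖opOf x‖} + ν {x | t ≤ ‖opOf x‖}ᶜ := by
        rw [← measure_univ (μ := ν), ← Set.union_compl_self {x | t ≤ ‖opOf x‖}]
        exact measure_union_le _ _
      rw [ENNReal.ofReal_sub _ hP, ENNReal.ofReal_one]
      refine tsub_le_iff_left.2 (h2.trans ?_)
      gcongr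
    refine h1.trans (measure_mono fun x hx ↦ ?_)
    simp only [Set.mem_compl_iff, Set.mem_ofPred_eq, not_le] at hx
    simp only [Set.mem_preimage, Set.mem_ofPred_eq]
    obtain ⟨p, q, s, hs, hs0, hsx, hGeq⟩ := hGx (F A + x)
    have hkn : k < n := hkr.trans_lt r.2
    let j : Fin n := ⟨k - 1, by omega⟩
    let k' : Fin n := ⟨k, hkn⟩
    -- Zero-based indices: `sv A j` is `σ_k` and `sv A r` is `σ_{r+1}`, which is at most `σ_c` since
    -- `c ≤ r + 1`.
    have hτ : sv A r ≤ (1 - γ) * sv A j :=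
      (LinearMap.singularValues_antitone _ (by omega : c - 1 ≤ (r : ℕ))).trans hc
    -- `e = 2 * t`: one `t` for the noise and one for the rounding to the grid.
    have key := norm_sub_truncation_le (u := u A) (v := v A) (p := p) (q := q) (σ := sv A)
      (φ := softCut (2 / γ) (sv A r) ∘ sv A) (s := s) (e := 2 * t) hγ hγ1 (j := j) (k := k')
      (by simp only [j, k']; omega) (hsv A) (hsv0 A)
      (fun a b hab ↦ softCut_mono hC0 (hsv A hab)) (fun i ↦ softCut_nonneg hC0 (hsv0 A i))
      (fun i ↦ softCut_le) hs hs0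
      -- Slope `2/γ` suffices because `(2 - γ)(1 - γ/2) ≥ 2(1 - γ)`.
      (fun i hi ↦ by
        refine softCut_of_mul_le hC0 ?_
        have h3 : 2 / γ - 1 = (2 - γ) / γ := by field_simp
        rw [h3, div_mul_eq_mul_div, div_mul_eq_mul_div, div_le_div_iff_of_pos_right hγ]
        nlinarith [mul_lt_mul_of_pos_left hi (by linarith : 0 < 2 - γ),
          mul_nonneg (sq_nonneg γ) (hsv0 A j)])
      (by
        have h4 : diagOp p s q - diagOp (u A) (softCut (2 / γ) (sv A r) ∘ sv A) (v A)
            = (diagOp p s q - opOf (F A + x)) + opOf x := by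
          rw [opOf_add, opOf_ofOp]; abel
        rw [h4]
        linarith [norm_add_le (diagOp p s q - opOf (F A + x)) (opOf x)])
    rw [spectralNorm₂, map_sub, hGeq, huv A]
    have h5 : sigma (k + 1) A = sv A k' := by simp [sigma, sv, k']
    rw [h5]
    refine key.trans (le_of_eq ?_)
    ring

/-- The accuracy requirement is void, so the constant output `0` serves. -/
lemma exists_mechanism_of_not_decay {γ Γ ε δ e P : ℝ} (hε : 0 ≤ ε)
    (h : ∀ A : Matrix (Fin n) (Fin n) ℝ, ¬ HasSpectralDecay γ Γ k A) :
    ∃ M : RandomizedAlgorithm (Matrix (Fin n) (Fin n) ℝ) (Matrix (Fin n) (Fin n) ℝ),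
      IsDifferentiallyPrivate SpectralNeighbors ε δ M ∧ ApproximatesRank γ Γ k e P M := by
  refine ⟨fun _ ↦ ⟨Measure.dirac 0, inferInstance⟩, fun A A' _ S _ ↦ ?_, fun A ↦ ?_,
    fun A hA ↦ absurd hA (h A)⟩
  · refine le_add_right (le_mul_of_one_le_left' ?_)
    rw [ENNReal.one_le_ofReal]
    exact Real.one_le_exp hε
  · change ∀ᵐ B ∂(Measure.dirac (0 : Matrix (Fin n) (Fin n) ℝ)), B.rank ≤ k
    simp [ae_dirac_eq]

end Mechanism

/-! ### Choice of the threshold index and the noise scales -/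

theorem mainTheorem11 (γ Γ a : ℝ) (hγ : 0 < γ) (hγ1 : γ < 1) (ha : 0 < a) :
    ∃ K : ℝ, 0 < K ∧ ∀ n k : ℕ, 2 ≤ n → 1 ≤ k → k ≤ n →
      (∀ ε δ : ℝ, 0 < ε → ε ≤ 1 → 0 < δ → δ < 1 / 2 →
        ∃ M : RandomizedAlgorithm (Matrix (Fin n) (Fin n) ℝ) (Matrix (Fin n) (Fin n) ℝ),
          IsDifferentiallyPrivate SpectralNeighbors ε δ M ∧
          ApproximatesRank γ Γ k
            (K * (ε⁻¹ * (k : ℝ) ^ 2 * √((n : ℝ) * Real.log (1 / δ)) * Real.log n))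
            ((n : ℝ) ^ (-a)) M) ∧
      (∀ ε : ℝ, 0 < ε →
        ∃ M : RandomizedAlgorithm (Matrix (Fin n) (Fin n) ℝ) (Matrix (Fin n) (Fin n) ℝ),
          IsDifferentiallyPrivate SpectralNeighbors ε 0 M ∧
          ApproximatesRank γ Γ k
            (K * (ε⁻¹ * (k : ℝ) ^ 2 * (n : ℝ) * Real.log n))
            ((n : ℝ) ^ (-a)) M) := by
  refine ⟨52 * 128 * 2 * (a + 5) * max Γ 1 / γ ^ 2, by positivity, fun n k hn hk hkn ↦ ?_⟩
  -- The largest admissible decay index. It depends on `n`, `k`, `Γ` only, so using it reveals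
  -- nothing about `A`, and decay at any earlier index persists to it.
  set c := min n ⌊Γ * k⌋₊ with hc
  have hcmax (c' : ℕ) (h1 : c' ≤ n) (h2 : (c' : ℝ) ≤ Γ * k) : c' ≤ c :=
    le_min h1 (Nat.le_floor h2)
  rcases le_or_gt c k with hck | hck
  · have hno (A : Matrix (Fin n) (Fin n) ℝ) : ¬ HasSpectralDecay γ Γ k A := by
      rintro ⟨c', h1, h2, h3, -⟩
      have := hcmax c' h2 h3
      omega
    exact ⟨fun ε δ hε _ _ _ ↦ exists_mechanism_of_not_decay hε.le hno,
      fun ε hε ↦ exists_mechanism_of_not_decay hε.le hno⟩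
  have hcn : c ≤ n := min_le_left _ _
  have hcΓ : (c : ℝ) ≤ Γ * k := (Nat.le_floor_iff' (by omega)).1 (min_le_right _ _)
  let r : Fin n := ⟨c - 1, by omega⟩
  have hrc : (r : ℕ) + 1 = c := by simp only [r]; omega
  have hkr : k ≤ (r : ℕ) := by omega
  have hn0 : (0 : ℝ) < n := by exact_mod_cast (by omega : 0 < n)
  have hk1 : (1 : ℝ) ≤ k := by exact_mod_cast hk
  have hr1 : (1 : ℝ) ≤ (r : ℕ) := by exact_mod_cast hk.trans hkr
  have hrK : ((r : ℕ) : ℝ) ≤ max Γ 1 * k ^ 2 := by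
    have h1 : ((r : ℕ) : ℝ) + 1 = c := by exact_mod_cast hrc
    have h2 : Γ * k ≤ max Γ 1 * k := by gcongr; exact le_max_left _ _
    have h3 : max Γ 1 * k ≤ max Γ 1 * (k : ℝ) ^ 2 := by gcongr; nlinarith
    linarith
  -- The estimates below give `√r` in (i) and `r` in (ii), with `r ≤ Γ k` and no logarithm; `k²` and
  -- `log n` enter only as slack, with `n ≥ 2` giving `2 log n ≥ 1`.
  have hlog : 1 ≤ 2 * Real.log n := by
    have h1 : Real.log 2 ≤ Real.log n := Real.log_le_log (by norm_num) (by exact_mod_cast hn)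
    linarith [Real.log_two_gt_d9]
  have hrlog : ((r : ℕ) : ℝ) ≤ max Γ 1 * k ^ 2 * (2 * Real.log n) :=
    hrK.trans (le_mul_of_one_le_right (by positivity) hlog)
  have hP : 0 ≤ (n : ℝ) ^ (-a) := by positivity
  have hr' (c' : ℕ) (h1 : c' ≤ n) (h2 : (c' : ℝ) ≤ Γ * k) : c' ≤ r + 1 := hrc ▸ hcmax c' h1 h2
  refine ⟨fun ε δ hε hε1 hδ hδ1 ↦ ?_, fun ε hε ↦ ?_⟩
  · set l := Real.log (1 / δ) with hl
    have hl0 : 0 < l := Real.log_pos (by rw [lt_div_iff₀ hδ]; linarith)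
    set s := 4 * (2 / γ) * √(r : ℕ) * (2 * √l / ε) with hs
    have hs0 : 0 < s := by positivity
    have := isProbabilityMeasure_normalizedDensity
      (p := gaussDensity (EuclideanSpace ℝ (Fin n × Fin n)) s)
      (lintegral_exp_ne_zero (by fun_prop)) (lintegral_gaussDensity_ne_top hs0)
    have hmech := exists_mechanism (Γ := Γ) (ε := ε) (δ := δ) hγ hγ1 hk r hkr hr'
      (normalizedDensity (gaussDensity (EuclideanSpace ℝ (Fin n × Fin n)) s))
      -- Moments are available at rate `√n / s`, so a norm of order `√n s` makes the tail exponent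
      -- proportional to `n`.
      (t := 8 * (a + 5) * √n * s) (by positivity)
      (measure_le_norm_opOf_le_rpow (by omega) (r := √n / s) (by positivity) ha
        (by
          have := Real.mul_self_sqrt hn0.le
          field_simp
          linear_combination this)
        fun y z hy hz ↦ lintegral_exp_inner_tensor_gaussDensity_le hs0 hy hz) hP
      (fun x x' hx _ S hS ↦ gaussDensity_preimage_add_le hε hε1 hδ hδ1 (by positivity) hs hx hS)
    obtain ⟨M, hM1, hM2⟩ := hmech
    refine ⟨M, hM1, hM2.mono ?_⟩
    have hsr : √((r : ℕ) : ℝ) ≤ (r : ℕ) := Real.sqrt_le_iff.2 ⟨by linarith, by nlinarith⟩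
    rw [Real.sqrt_mul hn0.le]
    calc 52 / γ * (8 * (a + 5) * √n * s)
        = 52 * 128 * (a + 5) / γ ^ 2 * (ε⁻¹ * (√n * √l)) * √(r : ℕ) := by
          rw [hs]; field_simp; ring
      _ ≤ 52 * 128 * (a + 5) / γ ^ 2 * (ε⁻¹ * (√n * √l)) * (max Γ 1 * k ^ 2 * (2 * Real.log n)) := by
          gcongr
          exact hsr.trans hrlog
      _ = _ := by ring
  · set s := 6 * (2 / γ) * (r : ℕ) / ε with hs
    have hs0 : 0 < s := by positivity
    have := isProbabilityMeasure_normalizedDensity (p := nuclearDensity n s)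
      lintegral_nuclearDensity_ne_zero (lintegral_nuclearDensity_ne_top hs0)
    have hmech := exists_mechanism (Γ := Γ) (ε := ε) (δ := 0) hγ hγ1 hk r hkr hr'
      -- Here the moments reach only the rate `3 / (4s)`, which costs a further factor of order `√n`
      -- compared with Gaussian noise of scale `s`.
      (normalizedDensity (nuclearDensity n s)) (t := 8 * (a + 5) * n * (4 * s / 3)) (by positivity)
      (measure_le_norm_opOf_le_rpow (by omega) (r := 3 / (4 * s)) (by positivity) ha
        (by field_simp)
        fun y z hy hz ↦ lintegral_exp_inner_tensor_nuclearDensity_le hs0 hy hz) hP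
      (fun x x' _ hx S hS ↦ nuclearDensity_preimage_add_le (by positivity) hε hs hx hS)
    obtain ⟨M, hM1, hM2⟩ := hmech
    refine ⟨M, hM1, hM2.mono ?_⟩
    calc 52 / γ * (8 * (a + 5) * n * (4 * s / 3))
        = 52 * 128 * (a + 5) / γ ^ 2 * (ε⁻¹ * n) * (r : ℕ) := by
          rw [hs]; field_simp; ring
      _ ≤ 52 * 128 * (a + 5) / γ ^ 2 * (ε⁻¹ * n) * (max Γ 1 * k ^ 2 * (2 * Real.log n)) := by
          gcongr
      _ = _ := by ring
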